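/- Fix $K\ge 1$ and let $p$ be the transition matrix of an irreducible aperiodic Markov chain on $\{1,\dots,K\}$. For every $n\ge K$ let $(\mathcal V_k)_{k=1}^K$ be a partition of $\{1,\dots,n\}$ into nonempty sets with $\#\mathcal V_k=\alpha_k n+o(n)$ as $n\to\infty$, where $\alpha_k>0$ are fixed and $\sum_k\alpha_k=1$; let $\sigma(v)=k$ for $v\in\mathcal V_k$. The block Markov chain is the Markov chain on $\{1,\dots,n\}$ with transition probabilities $P_{x,y}=p_{\sigma(x),\sigma(y)}/\#\mathcal V_{\sigma(y)}$; let $\Pi_X$ be its equilibrium distribution. Let $\ell=\ell(n)$ satisfy $\ell=\lambda n^2+o(n^2)$ with $\lambda>0$ fixed. For a path $Z=(Z_t)_{t=0}^{\ell}$ in $\{1,\dots,n\}$ let $\widehat N_Z$ be the $n\times n$ matrix with entries $N_{Z,ij}=\sum_{t=0}^{\ell-1}\mathbf 1\{Z_t=i,\,Z_{t+1}=j\}$, and let $\widehat P_Z$ be the $n\times n$ matrix with entries $\widehat P_{Z,ij}=N_{Z,ij}/\sum_{k=1}^n N_{Z,ik}$ (with the convention $0/0=0$). For a real $n\times n$ matrix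 $M$ with singular values $s_1(M)\ge\dots\ge s_n(M)$ let $\nu_M=n^{-1}\sum_{i=1}^n\delta_{s_i(M)}$ be its empirical singular value distribution. Random measures $\mu_n$ on $\mathbb R$ converge weakly in probability to $\mu$ if $\int f\,d\mu_n\to\int f\,d\mu$ in probability for every bounded continuous $f:\mathbb R\to\mathbb R$. For each $n\ge K$ let $X=(X_t)_{t=0}^\ell$ and $Y=(Y_t)_{t=0}^\ell$ be sample paths of the block Markov chain, where $X$ starts in equilibrium (that is, $X_0\sim\Pi_X$) and $Y$ has an arbitrary initial distribution, which may depend on $n$. Put $M_X=\widehat N_X-\mathbb E[\widehat N_X]$ and $Q_X=\operatorname{diag}((\ell+1)\Pi_X)^{-1}M_X$. Then: (i) If $\nu_{M_X/\sqrt n}$ converges weakly in probability to a probability measure $\nu$, then $\nu_{\widehat N_Y/\sqrt n}$ converges weakly in probability to $\nu$. (ii) If $\nu_{\sqrt n\,Q_X}$ converges weakly in probability to a probability measure $\nu$, then $\nu_{\sqrt n\,\widehat P_Y}$ converges weakly in probability to $\nu$. -/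

import Mathlib

open MeasureTheory Filter Topology Asymptotics Matrix

namespace BlockMarkov

noncomputable section

/-- Aperiodicity (acyclicity) of a transition matrix: for every state, the greatest common divisor
of the possible return times is `1`, i.e. only `1` divides all of them. -/
def IsAperiodic {V : Type*} [Fintype V] [DecidableEq V] (P : Matrix V V ℝ) : Prop :=
  ∀ v : V, ∀ d : ℕ, (∀ t : ℕ, 1 ≤ t → 0 < (P ^ t) v v → d ∣ t) → d = 1

/-- `Pi` is an equilibrium distribution of the transition matrix `P`. -/
def IsEquilibrium {V : Type*} [Fintype V] (P : Matrix V V ℝ) (Pi : V → ℝ) : Prop :=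
  Pi ∈ stdSimplex ℝ V ∧ Pi ᵥ* P = Pi

/-- The transition matrix of the block Markov chain with cluster transition matrix `p` and
cluster assignment `σ`; the cluster `k` is the fibre of `σ` over `k`. -/
def blockTransition {V C : Type*} [Fintype V] [DecidableEq C] (p : Matrix C C ℝ) (σ : V → C) :
    Matrix V V ℝ :=
  Matrix.of fun x y => p (σ x) (σ y) / ((Finset.univ.filter fun v => σ v = σ y).card : ℝ)

/-- `Z = (Z_0, …, Z_ℓ)`, defined on the probability space `(Ω, ℙ)`, is a sample path of the Markov
chain on the finite state space `V` with initial distribution `ι` and transition matrix `P`. -/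
structure IsSamplePath {Ω V : Type*} [MeasurableSpace Ω] [MeasurableSpace V] {ℓ : ℕ}
    (ℙ : Measure Ω) (ι : V → ℝ) (P : Matrix V V ℝ) (Z : Fin (ℓ + 1) → Ω → V) : Prop where
  isProbabilityMeasure : IsProbabilityMeasure ℙ
  measurable : ∀ t, Measurable (Z t)
  law : ∀ z : Fin (ℓ + 1) → V,
    ℙ {ω | ∀ t, Z t ω = z t} =
      ENNReal.ofReal (ι (z 0) * ∏ t : Fin ℓ, P (z t.castSucc) (z t.succ))

/-- The empirical frequency matrix `N̂` of a path: the entry `(i, j)` counts the transitions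
from `i` to `j`. -/
def freqMatrix {V : Type*} [DecidableEq V] {ℓ : ℕ} (z : Fin (ℓ + 1) → V) : Matrix V V ℝ :=
  Matrix.of fun i j => ∑ t : Fin ℓ, if z t.castSucc = i ∧ z t.succ = j then (1 : ℝ) else 0

/-- The empirical transition matrix `P̂` of a path (rows without any transition are zero). -/
def empTransition {V : Type*} [Fintype V] [DecidableEq V] {ℓ : ℕ} (z : Fin (ℓ + 1) → V) :
    Matrix V V ℝ :=
  Matrix.of fun i j => freqMatrix z i j / ∑ k, freqMatrix z i k

/-- The centred frequency matrix `M = N̂ - 𝔼[N̂]` of a random path, as a random matrix. -/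
def centredFreq {Ω V : Type*} [MeasurableSpace Ω] [DecidableEq V] {ℓ : ℕ}
    (ℙ : Measure Ω) (Z : Fin (ℓ + 1) → Ω → V) (ω : Ω) : Matrix V V ℝ :=
  freqMatrix (fun t => Z t ω) -
    Matrix.of fun i j => ∫ ω', freqMatrix (fun t => Z t ω') i j ∂ℙ

/-- The random matrix `Q = diag((ℓ + 1) Pi)⁻¹ M`. -/
def rescaledFreq {Ω V : Type*} [MeasurableSpace Ω] [Fintype V] [DecidableEq V] {ℓ : ℕ}
    (ℙ : Measure Ω) (Pi : V → ℝ) (Z : Fin (ℓ + 1) → Ω → V) (ω : Ω) : Matrix V V ℝ :=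
  (Matrix.diagonal fun v => ((ℓ : ℝ) + 1) * Pi v)⁻¹ * centredFreq ℙ Z ω

/-- The empirical singular value distribution of an `n × n` real matrix. -/
def singularDist {n : ℕ} (M : Matrix (Fin n) (Fin n) ℝ) : Measure ℝ :=
  (n : ENNReal)⁻¹ •
    ∑ i : Fin n, Measure.dirac ((Matrix.toEuclideanLin M).singularValues (i : ℕ))

/-- A sequence of random measures on `ℝ` (the `n`-th one living on the space `Ω n`) converges
weakly in probability to `ν`. -/
def ConvergesWeaklyInProbability {Ω : ℕ → Type*} [∀ n, MeasurableSpace (Ω n)]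
    (ℙ : ∀ n, Measure (Ω n)) (ξ : ∀ n, Ω n → Measure ℝ) (ν : Measure ℝ) : Prop :=
  ∀ f : BoundedContinuousFunction ℝ ℝ, ∀ ε : ℝ, 0 < ε →
    Tendsto (fun n => ℙ n {ω | ε < |(∫ x, f x ∂(ξ n ω)) - ∫ x, f x ∂ν|}) atTop (𝓝 0)

end

end BlockMarkov

namespace BlockMarkov

/-! ### Singular values under perturbations that are small off a subspace of small codimension -/

section SingularValues

open Module

variable {E F : Type*} [NormedAddCommGroup E] [InnerProductSpace ℝ E] [FiniteDimensional ℝ E]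
  [NormedAddCommGroup F] [InnerProductSpace ℝ F] [FiniteDimensional ℝ F]

/-! Limits of empirical singular value distributions ignore perturbations of rank `o(n)` and row
rescalings by factors close to 1. Both are captured by `Comparable`: on a subspace of codimension
`r`, the norms of `A x` and `B x` agree up to a factor `1 + δ`. Then `s_{i+r}(A) ≤ (1 + δ) s_i(B)`
and conversely (`singularValues_add_le`), so integrals of compactly supported functions differ
little when `δ` and `r / n` are small. The limit being a probability measure rules out escape of
mass and extends this to bounded continuous functions (`exists_testFunctions`).

Three discrepancies separate the matrices of `X` and `Y`. The mean of the equilibrium counts is `ℓ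
Π_i P_ij`, which depends on `j` only through its cluster, so it vanishes on vectors with zero sum
over each cluster: codimension `K`. A change of the state at time 0 affects a single transition,
into the state at time 1: codimension 1. In (ii) the normalisations differ as well: `Y` has the
actual row sums, `X` has `(ℓ + 1) Π_i`. Their ratio is close to 1 except in `o(n)` rows, which are
annihilated by further linear conditions.

The laws are compared by domination. As `P_xy ≤ C Π_y` with `C` independent of `n`, the law of `Y`
after time 0 is at most `C` times that of `X` (`pathMean_tail_le`), so improbable events for the
tail of `X` are improbable for that of `Y` (`ConvergesWeaklyInProbability.transfer`).

The count of exceptional rows follows from Chebyshev: visits to a state have mean of order `n` and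
second moment `O(n)` around it. The latter (`pathMean_visits_sq_le`) is a martingale estimate from a
Poisson equation solved on the cluster chain and lifted; its constants also give the equilibrium
explicitly. -/

theorem norm_sq_eq_sum_singularValues (T : E →ₗ[ℝ] F) {n : ℕ} (hn : finrank ℝ E = n) (x : E) :
    ‖T x‖ ^ 2 = ∑ i : Fin n, T.singularValues i ^ 2 *
      ((T.isSymmetric_adjoint_comp_self.eigenvectorBasis hn).repr x i) ^ 2 := by
  set b := T.isSymmetric_adjoint_comp_self.eigenvectorBasis hn with hb
  have h1 : ‖T x‖ ^ 2 = inner ℝ ((LinearMap.adjoint T ∘ₗ T) x) x := by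
    rw [LinearMap.comp_apply, LinearMap.adjoint_inner_left, real_inner_self_eq_norm_sq]
  rw [h1, ← b.repr.inner_map_map, PiLp.inner_apply]
  refine Finset.sum_congr rfl fun i _ => ?_
  rw [hb, LinearMap.IsSymmetric.eigenvectorBasis_apply_self_apply, T.sq_singularValues_fin hn]
  simp
  ring

omit [FiniteDimensional ℝ E] in
theorem norm_sq_eq_sum_repr {n : ℕ} (b : OrthonormalBasis (Fin n) ℝ E) (x : E) :
    ‖x‖ ^ 2 = ∑ i : Fin n, (b.repr x i) ^ 2 := by
  rw [← b.repr.norm_map, EuclideanSpace.real_norm_sq_eq]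

theorem exists_submodule_forall_eq_zero {κ : Type*} [Fintype κ] (φ : κ → E →ₗ[ℝ] ℝ) :
    ∃ W : Submodule ℝ E, finrank ℝ E ≤ finrank ℝ W + Fintype.card κ ∧
      ∀ x ∈ W, ∀ k, φ k x = 0 := by
  refine ⟨LinearMap.ker (LinearMap.pi φ), ?_, fun x hx k => congrFun (LinearMap.mem_ker.mp hx) k⟩
  have h1 := (LinearMap.pi φ).finrank_range_add_finrank_ker
  have h2 : finrank ℝ (LinearMap.range (LinearMap.pi φ)) ≤ Fintype.card κ := by
    simpa using Submodule.finrank_le (LinearMap.range (LinearMap.pi φ))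
  omega

theorem exists_submodule_repr_eq_zero {n : ℕ} (b : OrthonormalBasis (Fin n) ℝ E)
    (S : Finset (Fin n)) :
    ∃ W : Submodule ℝ E, finrank ℝ E ≤ finrank ℝ W + S.card ∧
      ∀ x ∈ W, ∀ i ∈ S, b.repr x i = 0 := by
  obtain ⟨W, hW, h⟩ := exists_submodule_forall_eq_zero fun i : S => b.toBasis.coord i
  exact ⟨W, by simpa using hW, fun x hx i hi => by simpa using h x hx ⟨i, hi⟩⟩

theorem finrank_add_finrank_le_finrank_inf (U W : Submodule ℝ E) :
    finrank ℝ U + finrank ℝ W ≤ finrank ℝ (U ⊓ W : Submodule ℝ E) + finrank ℝ E := by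
  have h1 := Submodule.finrank_sup_add_finrank_inf_eq U W
  have h2 := Submodule.finrank_le (U ⊔ W)
  omega

/-- Courant–Fischer by counting dimensions: the first `i + r + 1` right singular vectors of `S`,
those of `T` from index `i` on, and `U` span dimensions adding up to more than `2n`. A common
nonzero vector gives the chain of inequalities. -/
theorem singularValues_add_le (S T : E →ₗ[ℝ] F) (U : Submodule ℝ E) (r : ℕ) (c : ℝ) (hc : 0 ≤ c)
    (hU : finrank ℝ E ≤ finrank ℝ U + r) (h : ∀ x ∈ U, ‖S x‖ ≤ c * ‖T x‖) (i : ℕ) :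
    S.singularValues (i + r) ≤ c * T.singularValues i := by
  rcases le_or_gt (finrank ℝ E) (i + r) with hi | hi
  · rw [S.singularValues_of_finrank_le hi]
    exact mul_nonneg hc (T.singularValues_nonneg i)
  obtain ⟨n, hn⟩ : ∃ n, finrank ℝ E = n := ⟨_, rfl⟩
  rw [hn] at hi hU
  set b := S.isSymmetric_adjoint_comp_self.eigenvectorBasis hn with hb
  set d := T.isSymmetric_adjoint_comp_self.eigenvectorBasis hn with hd
  obtain ⟨V, hV, hV0⟩ := exists_submodule_repr_eq_zero b (Finset.Ioi ⟨i + r, hi⟩)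
  obtain ⟨W, hW, hW0⟩ := exists_submodule_repr_eq_zero d (Finset.Iio ⟨i, by omega⟩)
  simp only [Fin.card_Ioi, Fin.card_Iio, hn] at hV hW
  have h1 := finrank_add_finrank_le_finrank_inf V W
  have h2 := finrank_add_finrank_le_finrank_inf (V ⊓ W) U
  have h3 : 0 < finrank ℝ (V ⊓ W ⊓ U : Submodule ℝ E) := by omega
  obtain ⟨⟨x, hx⟩, hx'⟩ := finrank_pos_iff_exists_ne_zero.mp h3
  have hx0 : x ≠ 0 := fun h => hx' (Subtype.ext h)
  obtain ⟨⟨hxV, hxW⟩, hxU⟩ := hx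
  have hxn : 0 < ‖x‖ := norm_pos_iff.mpr hx0
  have hS : S.singularValues (i + r) * ‖x‖ ≤ ‖S x‖ := by
    refine le_of_sq_le_sq ?_ (norm_nonneg _)
    rw [mul_pow, norm_sq_eq_sum_singularValues S hn, norm_sq_eq_sum_repr b, Finset.mul_sum]
    refine Finset.sum_le_sum fun j _ => ?_
    rcases lt_or_ge (⟨i + r, hi⟩ : Fin n) j with hj | hj
    · rw [← hb, hV0 x hxV j (Finset.mem_Ioi.mpr hj)]; simp
    · have := S.singularValues_antitone (show (j : ℕ) ≤ i + r from hj)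
      have h0 := S.singularValues_nonneg (i + r)
      gcongr
  have hT : ‖T x‖ ≤ T.singularValues i * ‖x‖ := by
    refine le_of_sq_le_sq ?_ (mul_nonneg (T.singularValues_nonneg i) hxn.le)
    rw [mul_pow, norm_sq_eq_sum_singularValues T hn, norm_sq_eq_sum_repr d, Finset.mul_sum]
    refine Finset.sum_le_sum fun j _ => ?_
    rcases lt_or_ge j (⟨i, by omega⟩ : Fin n) with hj | hj
    · rw [← hd, hW0 x hxW j (Finset.mem_Iio.mpr hj)]; simp
    · have := T.singularValues_antitone (show i ≤ (j : ℕ) from hj)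
      have h0 := T.singularValues_nonneg j
      gcongr
  refine le_of_mul_le_mul_right ?_ hxn
  calc S.singularValues (i + r) * ‖x‖ ≤ ‖S x‖ := hS
    _ ≤ c * ‖T x‖ := h x hxU
    _ ≤ c * (T.singularValues i * ‖x‖) := by gcongr
    _ = c * T.singularValues i * ‖x‖ := by ring

end SingularValues

/-- On a subspace of codimension at most `r`, the norms `‖A x‖` and `‖B x‖` agree up to a factor
`1 + δ`. -/
def Comparable {n : ℕ} (δ : ℝ) (r : ℕ) (A B : Matrix (Fin n) (Fin n) ℝ) : Prop :=
  ∃ U : Submodule ℝ (EuclideanSpace ℝ (Fin n)), n ≤ Module.finrank ℝ U + r ∧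
    ∀ x ∈ U, ‖Matrix.toEuclideanLin A x‖ ≤ (1 + δ) * ‖Matrix.toEuclideanLin B x‖ ∧
      ‖Matrix.toEuclideanLin B x‖ ≤ (1 + δ) * ‖Matrix.toEuclideanLin A x‖

theorem Comparable.mono {n : ℕ} {δ δ' : ℝ} {r : ℕ} {A B : Matrix (Fin n) (Fin n) ℝ}
    (h : Comparable δ r A B) (hδ : δ ≤ δ') : Comparable δ' r A B := by
  obtain ⟨U, hU, h⟩ := h
  refine ⟨U, hU, fun x hx => ⟨(h x hx).1.trans ?_, (h x hx).2.trans ?_⟩⟩ <;> gcongr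

/-! ### Stability of the empirical singular value distribution -/

theorem sum_range_sub_sum_shift_le {u : ℕ → ℝ} {R : ℝ} (h0 : ∀ i, 0 ≤ u i) (hR : ∀ i, u i ≤ R)
    (n r : ℕ) :
    ∑ i ∈ Finset.range n, (u i - u (i + r)) ≤ r * R := by
  have h1 : ∑ i ∈ Finset.range n, u i ≤ ∑ i ∈ Finset.range (r + n), u i :=
    Finset.sum_le_sum_of_subset_of_nonneg (Finset.range_mono (by omega)) fun i _ _ => h0 i
  rw [Finset.sum_range_add] at h1
  have h2 : ∑ i ∈ Finset.range r, u i ≤ r * R := by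
    simpa using Finset.sum_le_card_nsmul (Finset.range r) u R fun i _ => hR i
  simp only [Finset.sum_sub_distrib, add_comm _ r]
  linarith

/-- Truncation at `R` turns the factor `1 + δ` into an additive error `δ * R`. By monotonicity the
index shift costs a telescoping sum, at most `r * R` per sequence. -/
theorem sum_abs_min_sub_min_le {a b : ℕ → ℝ} {δ R : ℝ} {r : ℕ} (hδ : 0 ≤ δ) (hR : 0 ≤ R)
    (ha : ∀ i, 0 ≤ a i) (hb : ∀ i, 0 ≤ b i) (ha' : Antitone a) (hb' : Antitone b)
    (hab : ∀ i, a (i + r) ≤ (1 + δ) * b i) (hba : ∀ i, b (i + r) ≤ (1 + δ) * a i) (n : ℕ) :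
    ∑ i ∈ Finset.range n, |min (a i) R - min (b i) R| ≤ 2 * r * R + n * (δ * R) := by
  have key : ∀ {s t : ℝ}, 0 ≤ t → s ≤ (1 + δ) * t → min s R ≤ min t R + δ * R := by
    intro s t ht hst
    rcases le_total t R with h | h
    · rw [min_eq_left h]
      have := mul_le_mul_of_nonneg_left h hδ
      exact (min_le_left _ _).trans (by linarith)
    · rw [min_eq_right h]
      exact (min_le_right _ _).trans (by linarith [mul_nonneg hδ hR])
  have hpt : ∀ i, |min (a i) R - min (b i) R| ≤
      (min (a i) R - min (a (i + r)) R) + (min (b i) R - min (b (i + r)) R) + δ * R := by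
    intro i
    have h1 := key (hb i) (hab i)
    have h2 := key (ha i) (hba i)
    have h3 : min (a (i + r)) R ≤ min (a i) R := min_le_min_right _ (ha' (Nat.le_add_right i r))
    have h4 : min (b (i + r)) R ≤ min (b i) R := min_le_min_right _ (hb' (Nat.le_add_right i r))
    rw [abs_le]
    constructor <;> linarith
  refine (Finset.sum_le_sum fun i _ => hpt i).trans ?_
  rw [Finset.sum_add_distrib, Finset.sum_add_distrib, Finset.sum_const, Finset.card_range,
    nsmul_eq_mul]
  have h1 := sum_range_sub_sum_shift_le (u := fun i => min (a i) R)
    (fun i => le_min (ha i) hR) (fun i => min_le_right _ _) n r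
  have h2 := sum_range_sub_sum_shift_le (u := fun i => min (b i) R)
    (fun i => le_min (hb i) hR) (fun i => min_le_right _ _) n r
  linarith

theorem isProbabilityMeasure_singularDist {n : ℕ} (hn : 0 < n) (A : Matrix (Fin n) (Fin n) ℝ) :
    IsProbabilityMeasure (singularDist A) := by
  constructor
  simp only [singularDist, Measure.smul_apply, Measure.finsetSum_apply, measure_univ,
    Finset.sum_const, Finset.card_univ, Fintype.card_fin, smul_eq_mul, nsmul_eq_mul, mul_one]
  exact ENNReal.inv_mul_cancel (by simpa using hn.ne') (by simp)

theorem integral_singularDist {n : ℕ} (A : Matrix (Fin n) (Fin n) ℝ)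
    (g : BoundedContinuousFunction ℝ ℝ) :
    ∫ x, g x ∂(singularDist A) =
      (n : ℝ)⁻¹ * ∑ i ∈ Finset.range n, g ((Matrix.toEuclideanLin A).singularValues i) := by
  rw [singularDist, integral_smul_measure, integral_finsetSum_measure]
  · simp [Finset.sum_range]
  · intro i _
    exact g.integrable _

/-- A Lipschitz bound up to `η`: at distances beyond the modulus `τ`, the slope `2 * M / τ` already
absorbs the full oscillation `2 * M`. -/
theorem exists_abs_sub_le_add_mul {g : ℝ → ℝ} (hg : UniformContinuous g) {M : ℝ}
    (hM : ∀ x, |g x| ≤ M) {η : ℝ} (hη : 0 < η) :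
    ∃ L : ℝ, 0 ≤ L ∧ ∀ x y, |g x - g y| ≤ η + L * |x - y| := by
  obtain ⟨τ, hτ, h⟩ := Metric.uniformContinuous_iff.mp hg η hη
  have hM0 : 0 ≤ M := (abs_nonneg _).trans (hM 0)
  refine ⟨2 * M / τ, by positivity, fun x y => ?_⟩
  rcases lt_or_ge |x - y| τ with hxy | hxy
  · have := h (show dist x y < τ from hxy)
    rw [Real.dist_eq] at this
    have : 0 ≤ 2 * M / τ * |x - y| := by positivity
    linarith
  · have h1 : 2 * M ≤ 2 * M / τ * |x - y| := by
      rw [div_mul_eq_mul_div, le_div_iff₀ hτ]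
      gcongr
    have h2 := abs_sub (g x) (g y)
    linarith [hM x, hM y]

theorem exists_integral_singularDist_sub_le (g : BoundedContinuousFunction ℝ ℝ) {R : ℝ}
    (hR : 0 ≤ R) (hgR : ∀ x, R ≤ |x| → g x = 0) {η : ℝ} (hη : 0 < η) :
    ∃ δ : ℝ, 0 < δ ∧ ∀ (n r : ℕ) (A B : Matrix (Fin n) (Fin n) ℝ), 0 < n → (r : ℝ) ≤ δ * n →
      Comparable δ r A B → |∫ x, g x ∂(singularDist A) - ∫ x, g x ∂(singularDist B)| ≤ η := by
  have hcs : HasCompactSupport g := by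
    refine HasCompactSupport.intro (isCompact_Icc (a := -R) (b := R)) fun x hx => hgR x ?_
    by_contra h
    exact hx (abs_le.mp (not_le.mp h).le)
  obtain ⟨L, hL, hgL⟩ := exists_abs_sub_le_add_mul
    (hcs.uniformContinuous_of_continuous g.continuous) (M := ‖g‖)
    (fun x => g.norm_coe_le_norm x) (half_pos hη)
  -- In `3 * L * R`, two units come from the index shift `r ≤ δ * n` and one from the factor `1 +
  -- δ`.
  refine ⟨η / (2 * (3 * L * R + 1)), by positivity, fun n r A B hn hr hAB => ?_⟩
  set δ := η / (2 * (3 * L * R + 1)) with hδ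
  have hδ0 : 0 < δ := by positivity
  have hδη : 3 * L * R * δ ≤ η / 2 := by
    rw [hδ, mul_div_assoc', div_le_div_iff₀ (by positivity) (by norm_num)]
    nlinarith
  obtain ⟨U, hU, hUAB⟩ := hAB
  set a : ℕ → ℝ := fun i => (Matrix.toEuclideanLin A).singularValues i
  set b : ℕ → ℝ := fun i => (Matrix.toEuclideanLin B).singularValues i
  have hU' : Module.finrank ℝ (EuclideanSpace ℝ (Fin n)) ≤ Module.finrank ℝ U + r := by
    simpa using hU
  have hsum := sum_abs_min_sub_min_le (a := a) (b := b) hδ0.le hR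
    (LinearMap.singularValues_nonneg _) (LinearMap.singularValues_nonneg _)
    (LinearMap.singularValues_antitone _) (LinearMap.singularValues_antitone _)
    (singularValues_add_le _ _ U r (1 + δ) (by positivity) hU' fun x hx => (hUAB x hx).1)
    (singularValues_add_le _ _ U r (1 + δ) (by positivity) hU' fun x hx => (hUAB x hx).2) n
  have hmin : ∀ s : ℝ, 0 ≤ s → g s = g (min s R) := by
    intro s hs
    rcases le_total s R with h | h
    · rw [min_eq_left h]
    · rw [min_eq_right h, hgR s (by rwa [abs_of_nonneg hs]), hgR R (le_abs_self R)]
  have hn' : (0 : ℝ) < n := by exact_mod_cast hn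
  rw [integral_singularDist, integral_singularDist, ← mul_sub, ← Finset.sum_sub_distrib, abs_mul,
    abs_of_pos (inv_pos.mpr hn'), inv_mul_le_iff₀ hn']
  calc |∑ i ∈ Finset.range n, (g (a i) - g (b i))|
      ≤ ∑ i ∈ Finset.range n, |g (a i) - g (b i)| := Finset.abs_sum_le_sum_abs _ _
    _ ≤ ∑ i ∈ Finset.range n, (η / 2 + L * |min (a i) R - min (b i) R|) := by
        refine Finset.sum_le_sum fun i _ => ?_
        rw [hmin (a i) (LinearMap.singularValues_nonneg _ _),
          hmin (b i) (LinearMap.singularValues_nonneg _ _)]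
        exact hgL _ _
    _ = n * (η / 2) + L * ∑ i ∈ Finset.range n, |min (a i) R - min (b i) R| := by
        rw [Finset.sum_add_distrib, Finset.mul_sum]; simp
    _ ≤ n * (η / 2) + L * (2 * r * R + n * (δ * R)) := by gcongr
    _ ≤ n * (η / 2) + L * (2 * (δ * n) * R + n * (δ * R)) := by gcongr
    _ = n * (η / 2 + 3 * L * R * δ) := by ring
    _ ≤ n * η := by
        gcongr
        linarith

/-- The continuous cutoff with value `1` on `[-(R - 1), R - 1]` and `0` off `[-R, R]`. -/
noncomputable def cutoff (R : ℝ) : BoundedContinuousFunction ℝ ℝ :=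
  BoundedContinuousFunction.mkOfBound ⟨fun x => max 0 (min 1 (R - |x|)), by fun_prop⟩ 1 (by
    intro x y
    rw [Real.dist_eq, abs_le]
    have h : ∀ z : ℝ, 0 ≤ max 0 (min 1 (R - |z|)) ∧ max 0 (min 1 (R - |z|)) ≤ 1 := fun z =>
      ⟨le_max_left _ _, max_le zero_le_one (min_le_left _ _)⟩
    constructor <;> simp only [ContinuousMap.coe_mk] <;> linarith [h x, h y])

theorem cutoff_apply (R x : ℝ) : cutoff R x = max 0 (min 1 (R - |x|)) := rfl

theorem cutoff_nonneg (R x : ℝ) : 0 ≤ cutoff R x := le_max_left _ _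

theorem cutoff_le_one (R x : ℝ) : cutoff R x ≤ 1 := max_le zero_le_one (min_le_left _ _)

theorem cutoff_eq_zero {R x : ℝ} (h : R ≤ |x|) : cutoff R x = 0 := by
  rw [cutoff_apply]
  exact max_eq_left ((min_le_right _ _).trans (by linarith))

theorem exists_integral_cutoff_ge (ν : Measure ℝ) [IsProbabilityMeasure ν] {η : ℝ} (hη : 0 < η) :
    ∃ R : ℝ, 0 ≤ R ∧ 1 - η ≤ ∫ x, cutoff R x ∂ν := by
  have h : Tendsto (fun k : ℕ => ∫ x, cutoff (k : ℝ) x ∂ν) atTop (𝓝 (∫ _, (1 : ℝ) ∂ν)) := by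
    refine tendsto_integral_of_dominated_convergence (fun _ => (1 : ℝ))
      (fun k => (cutoff (k : ℝ)).continuous.aestronglyMeasurable) (integrable_const _)
      (fun k => ae_of_all _ fun x => ?_) (ae_of_all _ fun x => ?_)
    · rw [Real.norm_eq_abs, abs_of_nonneg (cutoff_nonneg _ _)]
      exact cutoff_le_one _ _
    · refine tendsto_const_nhds.congr' ?_
      obtain ⟨m, hm⟩ := exists_nat_ge (|x| + 1)
      filter_upwards [eventually_ge_atTop m] with k hk
      have : (m : ℝ) ≤ k := by exact_mod_cast hk
      rw [cutoff_apply, min_eq_left (by linarith), max_eq_right zero_le_one]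
  simp only [integral_const, probReal_univ, smul_eq_mul, mul_one] at h
  obtain ⟨k, hk⟩ := (h.eventually (lt_mem_nhds (show 1 - η < 1 by linarith))).exists
  exact ⟨k, Nat.cast_nonneg k, hk.le⟩

/-- The truncation error is governed by the integral of a single test function, so tightness can
itself be transferred between comparable matrices. -/
theorem abs_integral_sub_mul_cutoff_le (μ : Measure ℝ) [IsProbabilityMeasure μ]
    (f : BoundedContinuousFunction ℝ ℝ) (R : ℝ) :
    |∫ x, f x ∂μ - ∫ x, (f * cutoff R) x ∂μ| ≤ ‖f‖ * (1 - ∫ x, cutoff R x ∂μ) := by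
  have h1 : ‖f‖ * (1 - ∫ x, cutoff R x ∂μ) = ∫ x, ‖f‖ * (1 - cutoff R x) ∂μ := by
    rw [integral_const_mul, integral_sub (integrable_const _) ((cutoff R).integrable μ)]
    simp
  rw [h1, ← integral_sub (f.integrable μ) ((f * cutoff R).integrable μ), ← Real.norm_eq_abs]
  refine norm_integral_le_of_norm_le
    (((integrable_const _).sub ((cutoff R).integrable μ)).const_mul _) (ae_of_all _ fun x => ?_)
  rw [BoundedContinuousFunction.coe_mul, Pi.mul_apply,
    show f x - f x * cutoff R x = f x * (1 - cutoff R x) by ring, norm_mul]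
  have h2 := cutoff_le_one R x
  rw [Real.norm_of_nonneg (sub_nonneg.mpr h2)]
  exact mul_le_mul_of_nonneg_right (f.norm_coe_le_norm x) (sub_nonneg.mpr h2)

/-- Closeness of the singular value distribution to a probability measure, tested on suitable
functions, is inherited by comparable matrices. -/
theorem exists_testFunctions (ν : Measure ℝ) [IsProbabilityMeasure ν]
    (f : BoundedContinuousFunction ℝ ℝ) {ε : ℝ} (hε : 0 < ε) :
    ∃ (h χ : BoundedContinuousFunction ℝ ℝ) (δ : ℝ), 0 < δ ∧
      ∀ (n r : ℕ) (A B : Matrix (Fin n) (Fin n) ℝ), 0 < n → (r : ℝ) ≤ δ * n →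
        Comparable δ r A B →
        |∫ x, h x ∂(singularDist A) - ∫ x, h x ∂ν| ≤ δ →
        |∫ x, χ x ∂(singularDist A) - ∫ x, χ x ∂ν| ≤ δ →
        |∫ x, f x ∂(singularDist B) - ∫ x, f x ∂ν| ≤ ε := by
  -- Truncating `f` costs `3 * η * ‖f‖` for `B` and `η * ‖f‖` for `ν`; passing from `B` to `A` and
  -- from `A` to `ν` costs `η` each.
  set η := ε / (4 * ‖f‖ + 2) with hη
  have hf0 := norm_nonneg f
  have hη0 : 0 < η := by positivity
  obtain ⟨R, hR, hRν⟩ := exists_integral_cutoff_ge ν hη0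
  obtain ⟨δ₁, hδ₁, H₁⟩ := exists_integral_singularDist_sub_le (f * cutoff R) hR
    (fun x hx => by simp [cutoff_eq_zero hx]) hη0
  obtain ⟨δ₂, hδ₂, H₂⟩ := exists_integral_singularDist_sub_le (cutoff R) hR
    (fun x hx => cutoff_eq_zero hx) hη0
  refine ⟨f * cutoff R, cutoff R, min η (min δ₁ δ₂), by positivity, ?_⟩
  intro n r A B hn hr hAB hh hχ
  have hn' : (0 : ℝ) < n := by exact_mod_cast hn
  have h1 : min η (min δ₁ δ₂) ≤ δ₁ := (min_le_right _ _).trans (min_le_left _ _)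
  have h2 : min η (min δ₁ δ₂) ≤ δ₂ := (min_le_right _ _).trans (min_le_right _ _)
  have h3 : min η (min δ₁ δ₂) ≤ η := min_le_left _ _
  have e1 := H₁ n r A B hn (hr.trans (by gcongr)) (hAB.mono h1)
  have e2 := H₂ n r A B hn (hr.trans (by gcongr)) (hAB.mono h2)
  have e3 := hh.trans h3
  have e4 := hχ.trans h3
  have := isProbabilityMeasure_singularDist hn B
  have e5 := abs_integral_sub_mul_cutoff_le (singularDist B) f R
  have e6 := abs_integral_sub_mul_cutoff_le ν f R
  have e7 : 1 - ∫ x, cutoff R x ∂(singularDist B) ≤ 3 * η := by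
    rw [abs_le] at e2 e4
    linarith
  have e8 : ‖f‖ * (1 - ∫ x, cutoff R x ∂(singularDist B)) ≤ ‖f‖ * (3 * η) := by gcongr
  have e9 : ‖f‖ * (1 - ∫ x, cutoff R x ∂ν) ≤ ‖f‖ * η := by
    gcongr
    linarith
  have e10 : ε = 4 * (‖f‖ * η) + 2 * η := by
    rw [hη]
    field_simp
  rw [abs_le] at e1 e3 e5 e6 ⊢
  constructor <;> linarith

/-! ### Path weights of Markov chains on finite state spaces -/

section Paths

variable {V : Type*} [Fintype V]

/-- The probability of the path `z` under the initial distribution `ι` and the transition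
matrix `P`. -/
noncomputable def pathWeight {ℓ : ℕ} (ι : V → ℝ) (P : Matrix V V ℝ) (z : Fin (ℓ + 1) → V) : ℝ :=
  ι (z 0) * ∏ t : Fin ℓ, P (z t.castSucc) (z t.succ)

/-- The expectation of a function of the path. -/
noncomputable def pathMean {ℓ : ℕ} (ι : V → ℝ) (P : Matrix V V ℝ)
    (F : (Fin (ℓ + 1) → V) → ℝ) : ℝ :=
  ∑ z, pathWeight ι P z * F z

variable {ℓ : ℕ} {ι : V → ℝ} {P : Matrix V V ℝ}

omit [Fintype V] in
theorem pathWeight_nonneg (hι : ∀ x, 0 ≤ ι x) (hP : ∀ x y, 0 ≤ P x y) (z : Fin (ℓ + 1) → V) :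
    0 ≤ pathWeight ι P z :=
  mul_nonneg (hι _) (Finset.prod_nonneg fun _ _ => hP _ _)

omit [Fintype V] in
theorem pathWeight_cons (x : V) (w : Fin (ℓ + 1) → V) :
    pathWeight (ℓ := ℓ + 1) ι P (Fin.cons x w) = ι x * pathWeight (P x) P w := by
  simp [pathWeight, Fin.prod_univ_succ]

/-- The Markov property as first-step decomposition: after a start in `x`, the rest is a chain with
initial distribution `P x`. Inductions on the length rest on it. -/
theorem pathMean_succ (F : (Fin (ℓ + 1 + 1) → V) → ℝ) :
    pathMean ι P F = ∑ x, ι x * pathMean (P x) P fun w : Fin (ℓ + 1) → V => F (Fin.cons x w) := by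
  rw [pathMean, ← (Fin.consEquiv fun _ => V).sum_comp, Fintype.sum_prod_type]
  refine Finset.sum_congr rfl fun x _ => ?_
  rw [pathMean, Finset.mul_sum]
  refine Finset.sum_congr rfl fun w _ => ?_
  change pathWeight ι P (Fin.cons x w) * F (Fin.cons x w) = _
  rw [pathWeight_cons, mul_assoc]

theorem pathMean_mono (hι : ∀ x, 0 ≤ ι x) (hP : ∀ x y, 0 ≤ P x y)
    {F H : (Fin (ℓ + 1) → V) → ℝ} (h : ∀ z, F z ≤ H z) : pathMean ι P F ≤ pathMean ι P H :=
  Finset.sum_le_sum fun z _ => mul_le_mul_of_nonneg_left (h z) (pathWeight_nonneg hι hP z)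

theorem pathMean_add (F H : (Fin (ℓ + 1) → V) → ℝ) :
    pathMean ι P (fun z => F z + H z) = pathMean ι P F + pathMean ι P H := by
  simp [pathMean, mul_add, Finset.sum_add_distrib]

theorem pathMean_const_mul (c : ℝ) (F : (Fin (ℓ + 1) → V) → ℝ) :
    pathMean ι P (fun z => c * F z) = c * pathMean ι P F := by
  simp [pathMean, Finset.mul_sum, mul_left_comm]

theorem pathMean_sum {κ : Type*} (s : Finset κ) (F : κ → (Fin (ℓ + 1) → V) → ℝ) :
    pathMean ι P (fun z => ∑ k ∈ s, F k z) = ∑ k ∈ s, pathMean ι P (F k) := by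
  simp only [pathMean, Finset.mul_sum]
  exact Finset.sum_comm

theorem pathMean_apply_zero (hP : ∀ x, ∑ y, P x y = 1) (φ : V → ℝ) :
    pathMean ι P (fun z : Fin (ℓ + 1) → V => φ (z 0)) = ∑ x, ι x * φ x := by
  induction ℓ generalizing ι φ with
  | zero =>
    rw [pathMean, ← (Equiv.funUnique (Fin 1) V).symm.sum_comp]
    simp [pathWeight]
  | succ m ih =>
    rw [pathMean_succ]
    refine Finset.sum_congr rfl fun x _ => ?_
    have := ih (ι := P x) (fun _ => φ x)
    simp only [Fin.cons_zero]
    rw [this, ← Finset.sum_mul, hP, one_mul]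

theorem pathMean_const (hι : ∑ x, ι x = 1) (hP : ∀ x, ∑ y, P x y = 1) (c : ℝ) :
    pathMean ι P (fun _ : Fin (ℓ + 1) → V => c) = c := by
  rw [pathMean_apply_zero hP fun _ => c, ← Finset.sum_mul, hι, one_mul]

theorem sum_mul_pathMean_row {q : V → ℝ} (F : (Fin (ℓ + 1) → V) → ℝ) :
    ∑ x, q x * pathMean (P x) P F = pathMean (q ᵥ* P) P F := by
  simp only [pathMean, pathWeight, Finset.mul_sum, Matrix.vecMul, dotProduct]
  rw [Finset.sum_comm]
  refine Finset.sum_congr rfl fun z _ => ?_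
  rw [Finset.sum_mul, Finset.sum_mul]
  exact Finset.sum_congr rfl fun x _ => by ring

/-- The state at time 1 has a mixture of rows of `P` as its law, and each row is at most `C * q`.
Path weights are linear in the initial weights, and `q` is its own law at time 1. -/
theorem pathMean_tail_le {q : V → ℝ} {C : ℝ} (hι : ι ∈ stdSimplex ℝ V) (hq : q ᵥ* P = q)
    (hP : ∀ x y, 0 ≤ P x y) (hC : ∀ x y, P x y ≤ C * q y)
    {F : (Fin (ℓ + 1) → V) → ℝ} (hF : ∀ z, 0 ≤ F z) :
    pathMean ι P (fun z : Fin (ℓ + 1 + 1) → V => F fun t => z t.succ) ≤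
      C * pathMean q P (fun z : Fin (ℓ + 1 + 1) → V => F fun t => z t.succ) := by
  rw [pathMean_succ, pathMean_succ]
  simp only [Fin.cons_succ]
  rw [sum_mul_pathMean_row (q := q), hq]
  have h : ∀ x, pathMean (P x) P F ≤ C * pathMean q P F := by
    intro x
    simp only [pathMean, pathWeight, Finset.mul_sum]
    refine Finset.sum_le_sum fun z _ => ?_
    rw [← mul_assoc, ← mul_assoc]
    refine mul_le_mul_of_nonneg_right ?_ (hF z)
    exact mul_le_mul_of_nonneg_right (hC x _) (Finset.prod_nonneg fun _ _ => hP _ _)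
  calc ∑ x, ι x * pathMean (P x) P F ≤ ∑ x, ι x * (C * pathMean q P F) :=
        Finset.sum_le_sum fun x _ => mul_le_mul_of_nonneg_left (h x) (hι.1 x)
    _ = C * pathMean q P F := by rw [← Finset.sum_mul, hι.2, one_mul]

/-- A second moment bound for additive functionals, from a solution `G` of the Poisson equation
`u = G - P G`. -/
theorem pathMean_sq_add_le {u G : V → ℝ} {v : ℝ} (hP : ∀ x y, 0 ≤ P x y)
    (hP1 : ∀ x, ∑ y, P x y = 1) (hG : ∀ x, G x = u x + ∑ y, P x y * G y)
    (hv : ∀ x, ∑ y, P x y * G y ^ 2 ≤ v) (hι : ∀ x, 0 ≤ ι x) (hι1 : ∑ x, ι x = 1) (a : ℝ) :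
    pathMean ι P (fun z : Fin (ℓ + 1) → V =>
        (a + ∑ t : Fin ℓ, u (z t.castSucc) + G (z (Fin.last ℓ))) ^ 2) ≤
      ∑ x, ι x * (a + G x) ^ 2 + ℓ * v := by
  -- The offset `a` stays free because prepending a state `x` moves `u x` into it.
  induction ℓ generalizing ι a with
  | zero =>
    have := pathMean_apply_zero (ℓ := 0) (ι := ι) hP1 fun x => (a + G x) ^ 2
    simpa using this.le
  | succ m ih =>
    rw [pathMean_succ]
    have h1 : ∀ x, pathMean (P x) P (fun w : Fin (m + 1) → V =>
        (a + ∑ t : Fin (m + 1), u ((Fin.cons x w : Fin (m + 1 + 1) → V) t.castSucc) +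
          G ((Fin.cons x w : Fin (m + 1 + 1) → V) (Fin.last (m + 1)))) ^ 2) ≤
        (a + G x) ^ 2 + (m + 1) * v := by
      intro x
      have h2 := ih (hP x) (hP1 x) (a + u x)
      have h3 : ∀ w : Fin (m + 1) → V,
          a + ∑ t : Fin (m + 1), u ((Fin.cons x w : Fin (m + 1 + 1) → V) t.castSucc) +
            G ((Fin.cons x w : Fin (m + 1 + 1) → V) (Fin.last (m + 1))) =
          (a + u x) + ∑ t : Fin m, u (w t.castSucc) + G (w (Fin.last m)) := by
        intro w
        rw [Fin.sum_univ_succ, ← Fin.succ_last, Fin.cons_succ]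
        simp only [Fin.castSucc_zero, Fin.cons_zero, ← Fin.succ_castSucc, Fin.cons_succ]
        ring
      simp only [h3]
      refine h2.trans ?_
      have h4 : ∑ y, P x y * (a + u x + G y) ^ 2 =
          (a + u x) ^ 2 + 2 * (a + u x) * ∑ y, P x y * G y + ∑ y, P x y * G y ^ 2 := by
        calc ∑ y, P x y * (a + u x + G y) ^ 2
            = ∑ y, (P x y * (a + u x) ^ 2 + 2 * (a + u x) * (P x y * G y) + P x y * G y ^ 2) :=
              Finset.sum_congr rfl fun y _ => by ring
          _ = _ := by
              rw [Finset.sum_add_distrib, Finset.sum_add_distrib, ← Finset.sum_mul, hP1,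
                ← Finset.mul_sum, one_mul]
      rw [h4]
      have h5 := hv x
      -- With `P G = G - u`, the expansion exceeds `(a + G x) ^ 2` by the conditional variance of
      -- `G`, at most its second moment, hence at most `v`.
      have h6 := sq_nonneg (∑ y, P x y * G y)
      rw [hG x]
      nlinarith
    calc _ ≤ ∑ x, ι x * ((a + G x) ^ 2 + (m + 1) * v) :=
          Finset.sum_le_sum fun x _ => mul_le_mul_of_nonneg_left (h1 x) (hι x)
      _ = _ := by
          simp only [mul_add, Finset.sum_add_distrib, ← Finset.sum_mul, hι1]
          push_cast
          ring

theorem pathMean_sq_le {u G : V → ℝ} {v Γ : ℝ} (hP : ∀ x y, 0 ≤ P x y)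
    (hP1 : ∀ x, ∑ y, P x y = 1) (hG : ∀ x, G x = u x + ∑ y, P x y * G y)
    (hv : ∀ x, ∑ y, P x y * G y ^ 2 ≤ v) (hΓ : ∀ x, G x ^ 2 ≤ Γ)
    (hι : ∀ x, 0 ≤ ι x) (hι1 : ∑ x, ι x = 1) :
    pathMean ι P (fun z : Fin (ℓ + 1) → V => (∑ t : Fin ℓ, u (z t.castSucc)) ^ 2) ≤
      4 * Γ + 2 * (ℓ * v) := by
  have h1 := pathMean_sq_add_le (ℓ := ℓ) hP hP1 hG hv hι hι1 0
  have h2 : ∑ x, ι x * (0 + G x) ^ 2 ≤ Γ := by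
    calc ∑ x, ι x * (0 + G x) ^ 2 ≤ ∑ x, ι x * Γ :=
          Finset.sum_le_sum fun x _ =>
            mul_le_mul_of_nonneg_left (by simpa using hΓ x) (hι x)
      _ = Γ := by rw [← Finset.sum_mul, hι1, one_mul]
  calc _ ≤ pathMean ι P (fun z : Fin (ℓ + 1) → V =>
        2 * (0 + ∑ t : Fin ℓ, u (z t.castSucc) + G (z (Fin.last ℓ))) ^ 2 + 2 * Γ) := by
        refine pathMean_mono hι hP fun z => ?_
        have := hΓ (z (Fin.last ℓ))
        -- With `s` the sum, `2 * (s + G) ^ 2 + 2 * G ^ 2 - s ^ 2 = (s + 2 * G) ^ 2`, which removes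
        -- the boundary term.
        nlinarith [sq_nonneg (∑ t : Fin ℓ, u (z t.castSucc) + 2 * G (z (Fin.last ℓ)))]
    _ ≤ 4 * Γ + 2 * (ℓ * v) := by
        rw [pathMean_add, pathMean_const_mul, pathMean_const hι1 hP1]
        linarith

/-! ### Transition counts -/

variable [DecidableEq V]

omit [Fintype V] in
theorem freqMatrix_cons (x : V) (w : Fin (ℓ + 1) → V) (i j : V) :
    freqMatrix (ℓ := ℓ + 1) (Fin.cons x w) i j =
      (if x = i then if w 0 = j then (1 : ℝ) else 0 else 0) + freqMatrix w i j := by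
  simp only [freqMatrix, Matrix.of_apply, Fin.sum_univ_succ, Fin.castSucc_zero, Fin.cons_zero,
    Fin.cons_succ, ← Fin.succ_castSucc, ite_and]

theorem pathMean_freqMatrix {q : V → ℝ} (hq : q ᵥ* P = q) (hP : ∀ x, ∑ y, P x y = 1)
    (i j : V) :
    pathMean q P (fun z : Fin (ℓ + 1) → V => freqMatrix z i j) = ℓ * (q i * P i j) := by
  induction ℓ with
  | zero => simp [pathMean, freqMatrix]
  | succ m ih =>
    rw [pathMean_succ]
    simp only [freqMatrix_cons, pathMean_add, mul_add, Finset.sum_add_distrib]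
    rw [sum_mul_pathMean_row, hq, ih]
    have h : ∀ x, pathMean (P x) P (fun w : Fin (m + 1) → V =>
        if x = i then if w 0 = j then (1 : ℝ) else 0 else 0) = if x = i then P x j else 0 := by
      intro x
      rw [pathMean_apply_zero hP fun y => if x = i then if y = j then (1 : ℝ) else 0 else 0]
      by_cases hx : x = i <;> simp [hx]
    simp only [h]
    simp
    ring

theorem freqMatrix_mulVec (z : Fin (ℓ + 1) → V) (x : V → ℝ) (i : V) :
    (freqMatrix z *ᵥ x) i = ∑ t : Fin ℓ, if z t.castSucc = i then x (z t.succ) else 0 := by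
  simp only [Matrix.mulVec, dotProduct, freqMatrix, Matrix.of_apply, Finset.sum_mul]
  rw [Finset.sum_comm]
  refine Finset.sum_congr rfl fun t _ => ?_
  by_cases h : z t.castSucc = i <;> simp [h]

theorem sum_freqMatrix (z : Fin (ℓ + 1) → V) (i : V) :
    ∑ k, freqMatrix z i k = ∑ t : Fin ℓ, if z t.castSucc = i then (1 : ℝ) else 0 := by
  have := freqMatrix_mulVec z (fun _ => 1) i
  simpa [Matrix.mulVec, dotProduct] using this

/-- Paths that agree after time `0` have the same transition counts, except for those into the
state at time `1`. -/
theorem freqMatrix_mulVec_eq_of_tail_eq {z w : Fin (ℓ + 1 + 1) → V}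
    (h : ∀ t : Fin (ℓ + 1), z t.succ = w t.succ) {x : V → ℝ} (hx : x (w 1) = 0) :
    freqMatrix z *ᵥ x = freqMatrix w *ᵥ x := by
  ext i
  rw [freqMatrix_mulVec, freqMatrix_mulVec, Fin.sum_univ_succ, Fin.sum_univ_succ]
  congr 1
  · have h0 := h 0
    rw [h0]
    have : (Fin.succ 0 : Fin (ℓ + 1 + 1)) = 1 := rfl
    simp [this, hx]
  · refine Finset.sum_congr rfl fun t _ => ?_
    rw [← Fin.succ_castSucc, h, h]

end Paths

/-! ### Sample paths -/

section SamplePath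

variable {Ω V : Type*} [MeasurableSpace Ω] [Fintype V] [MeasurableSpace V]
  [MeasurableSingletonClass V] {ℓ : ℕ} {ℙ : Measure Ω} {ι : V → ℝ} {P : Matrix V V ℝ}
  {Z : Fin (ℓ + 1) → Ω → V}

omit [Fintype V] in
theorem IsSamplePath.map_singleton (h : IsSamplePath ℙ ι P Z) (z : Fin (ℓ + 1) → V) :
    ℙ.map (fun ω t => Z t ω) {z} = ENNReal.ofReal (pathWeight ι P z) := by
  rw [Measure.map_apply (measurable_pi_lambda _ h.measurable) (measurableSet_singleton z),
    pathWeight, ← h.law z]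
  congr 1
  ext ω
  simp [funext_iff]

theorem IsSamplePath.measure_mem (h : IsSamplePath ℙ ι P Z) (hι : ∀ x, 0 ≤ ι x)
    (hP : ∀ x y, 0 ≤ P x y) (S : Set (Fin (ℓ + 1) → V)) :
    ℙ {ω | (fun t => Z t ω) ∈ S} = ENNReal.ofReal (pathMean ι P (S.indicator 1)) := by
  classical
  have h1 : ℙ {ω | (fun t => Z t ω) ∈ S} = ℙ.map (fun ω t => Z t ω) S :=
    (Measure.map_apply (measurable_pi_lambda _ h.measurable) S.toFinite.measurableSet).symm
  have h2 : pathMean ι P (S.indicator 1) = ∑ z ∈ S.toFinset, pathWeight ι P z := by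
    rw [pathMean, ← Finset.univ_inter S.toFinset, ← Finset.sum_ite_mem]
    exact Finset.sum_congr rfl fun z _ => by simp [Set.indicator_apply]
  rw [h1, h2, ENNReal.ofReal_sum_of_nonneg fun z _ => pathWeight_nonneg hι hP z,
    ← Finset.sum_congr rfl fun z _ => h.map_singleton z, sum_measure_singleton,
    Set.coe_toFinset]

theorem IsSamplePath.integral_eq (h : IsSamplePath ℙ ι P Z) (hι : ∀ x, 0 ≤ ι x)
    (hP : ∀ x y, 0 ≤ P x y) (F : (Fin (ℓ + 1) → V) → ℝ) :
    ∫ ω, F (fun t => Z t ω) ∂ℙ = pathMean ι P F := by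
  have := h.isProbabilityMeasure
  have hm : Measurable fun ω t => Z t ω := measurable_pi_lambda _ h.measurable
  have := Measure.isProbabilityMeasure_map (μ := ℙ) hm.aemeasurable
  have hF : Measurable F := measurable_of_countable F
  rw [← integral_map (φ := fun ω t => Z t ω) hm.aemeasurable hF.aestronglyMeasurable,
    integral_fintype Integrable.of_finite]
  refine Finset.sum_congr rfl fun z _ => ?_
  rw [Measure.real, h.map_singleton, ENNReal.toReal_ofReal (pathWeight_nonneg hι hP z),
    smul_eq_mul]

/-- The law of a sample path after time `0` is dominated by the one in equilibrium. -/
theorem IsSamplePath.measure_tail_le {Ω' : Type*} [MeasurableSpace Ω'] {ℙ' : Measure Ω'}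
    {q : V → ℝ} {Z' : Fin (ℓ + 1) → Ω' → V} {C : ℝ} (hℓ : 0 < ℓ) (h : IsSamplePath ℙ ι P Z)
    (h' : IsSamplePath ℙ' q P Z') (hι : ι ∈ stdSimplex ℝ V) (hq : IsEquilibrium P q)
    (hP : ∀ x y, 0 ≤ P x y) (hC0 : 0 ≤ C) (hC : ∀ x y, P x y ≤ C * q y)
    (S : Set (Fin ℓ → V)) :
    ℙ {ω | (fun t : Fin ℓ => Z t.succ ω) ∈ S} ≤
      ENNReal.ofReal C * ℙ' {ω | (fun t : Fin ℓ => Z' t.succ ω) ∈ S} := by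
  obtain ⟨m, rfl⟩ : ∃ m, ℓ = m + 1 := ⟨ℓ - 1, by omega⟩
  have e1 := h.measure_mem hι.1 hP {z | (fun t : Fin (m + 1) => z t.succ) ∈ S}
  have e2 := h'.measure_mem hq.1.1 hP {z | (fun t : Fin (m + 1) => z t.succ) ∈ S}
  simp only [Set.mem_ofPred_eq] at e1 e2
  rw [e1, e2, ← ENNReal.ofReal_mul hC0]
  refine ENNReal.ofReal_le_ofReal ?_
  exact pathMean_tail_le hι hq.2 hP hC (F := S.indicator 1)
    fun z => Set.indicator_nonneg (fun _ _ => zero_le_one) z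

end SamplePath

/-! ### The Poisson equation of an irreducible chain -/

section Poisson

variable {C : Type*} [Fintype C] [DecidableEq C] {p : Matrix C C ℝ}

/-- The minimum principle: at a minimiser, every power of `p` averages `g` to at most its minimum,
and irreducibility lets some power charge any given state. -/
theorem eq_of_mulVec_le (hp : p ∈ Matrix.rowStochastic ℝ C) (hirr : p.IsIrreducible) {g : C → ℝ}
    (hg : ∀ x, (p *ᵥ g) x ≤ g x) (x y : C) : g x = g y := by
  have : Nonempty C := ⟨x⟩
  obtain ⟨x₀, hx₀⟩ := Finite.exists_min g
  suffices h : ∀ y, g y = g x₀ by rw [h x, h y]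
  intro y
  have hpow : ∀ m : ℕ, ∀ x, ((p ^ m) *ᵥ g) x ≤ g x := by
    intro m
    induction m with
    | zero => simp
    | succ m ih =>
      intro x
      rw [pow_succ', ← Matrix.mulVec_mulVec]
      refine le_trans ?_ (hg x)
      exact Finset.sum_le_sum fun z _ => mul_le_mul_of_nonneg_left (ih z) (hirr.nonneg x z)
  obtain ⟨m, -, hm⟩ := (Matrix.isIrreducible_iff_exists_pow_pos hirr.nonneg).mp hirr x₀ y
  have hpm := pow_mem hp m
  have hnn : ∀ z, 0 ≤ (p ^ m) x₀ z * (g z - g x₀) := fun z =>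
    mul_nonneg (Matrix.nonneg_of_mem_rowStochastic hpm) (sub_nonneg.mpr (hx₀ z))
  have hle : ∑ z, (p ^ m) x₀ z * (g z - g x₀) ≤ 0 := by
    have h1 := hpow m x₀
    simp only [Matrix.mulVec, dotProduct] at h1
    simp only [mul_sub, Finset.sum_sub_distrib, ← Finset.sum_mul,
      Matrix.sum_row_of_mem_rowStochastic hpm]
    linarith
  have h0 := (Finset.sum_eq_zero_iff_of_nonneg fun z _ => hnn z).mp
    (le_antisymm hle (Finset.sum_nonneg fun z _ => hnn z)) y (Finset.mem_univ y)
  rcases mul_eq_zero.mp h0 with h | h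
  · exact absurd h hm.ne'
  · linarith

theorem mulVec_const (hp : p ∈ Matrix.rowStochastic ℝ C) {g : C → ℝ}
    (hg : ∀ x y, g x = g y) : p *ᵥ g = g := by
  ext x
  simp only [Matrix.mulVec, dotProduct]
  rw [Finset.sum_congr rfl fun y _ => by rw [hg y x], ← Finset.sum_mul,
    Matrix.sum_row_of_mem_rowStochastic hp, one_mul]

/-- The kernel of `1 - p` consists of constants. A constant in its range makes `g` or `-g`
superharmonic, hence constant, so it is zero. Kernel and range are therefore complementary by
rank–nullity. -/
theorem exists_poisson (hp : p ∈ Matrix.rowStochastic ℝ C) (hirr : p.IsIrreducible) (f : C → ℝ) :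
    ∃ (c : ℝ) (g : C → ℝ), ∀ x, f x = c + (g x - (p *ᵥ g) x) := by
  rcases isEmpty_or_nonempty C with hC | ⟨⟨o⟩⟩
  · exact ⟨0, 0, fun x => hC.elim x⟩
  let T : (C → ℝ) →ₗ[ℝ] (C → ℝ) := LinearMap.id - Matrix.mulVecLin p
  have hT : ∀ g, T g = g - p *ᵥ g := fun g => rfl
  have hconst : ∀ {g : C → ℝ}, T g = 0 → ∀ x y, g x = g y := by
    intro g hg
    rw [hT, sub_eq_zero] at hg
    exact eq_of_mulVec_le hp hirr fun x => (congrFun hg x).ge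
  have hdisj : Disjoint (LinearMap.ker T) (LinearMap.range T) := by
    rw [Submodule.disjoint_def]
    rintro _ hk ⟨g, rfl⟩
    have hc := hconst (LinearMap.mem_ker.mp hk)
    have key : ∀ g : C → ℝ, (∀ x, T g x = T g o) → 0 ≤ T g o → T g = 0 := by
      intro g hg h0
      have h1 : ∀ x, (p *ᵥ g) x ≤ g x := by
        intro x
        have := hg x
        rw [← this, hT] at h0
        simpa using h0
      rw [hT, mulVec_const hp (eq_of_mulVec_le hp hirr h1), sub_self]
    rcases le_total 0 (T g o) with h | h
    · exact key g (fun x => hc x o) h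
    · have := key (-g) (fun x => by simp [hc x o]) (by simpa using h)
      simpa using this
  have htop : LinearMap.ker T ⊔ LinearMap.range T = ⊤ := by
    refine Submodule.eq_top_of_disjoint _ _ ?_ hdisj
    rw [add_comm, T.finrank_range_add_finrank_ker]
  obtain ⟨u, hu, _, ⟨g, rfl⟩, hf⟩ := Submodule.mem_sup.mp (htop ▸ Submodule.mem_top (x := f))
  refine ⟨u o, g, fun x => ?_⟩
  rw [← hf, Pi.add_apply, hconst (LinearMap.mem_ker.mp hu) x o, hT]
  rfl

/-- Solutions of the Poisson equations for the indicators of the states; the constants are the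
equilibrium probabilities. -/
theorem exists_poisson_indicator (hp : p ∈ Matrix.rowStochastic ℝ C) (hirr : p.IsIrreducible) :
    ∃ (c : C → ℝ) (g : C → C → ℝ), (∀ k, 0 < c k) ∧
      ∀ k x, (if x = k then 1 else 0) = c k + (g k x - (p *ᵥ g k) x) := by
  choose c g h using fun k => exists_poisson hp hirr fun x => if x = k then (1 : ℝ) else 0
  refine ⟨c, g, fun k => ?_, h⟩
  -- If `c k ≤ 0`, then `g k` is superharmonic, hence constant, and the equation at `k` reads `1 = c
  -- k`.
  by_contra! hc
  have h1 : ∀ x, (p *ᵥ g k) x ≤ g k x := by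
    intro x
    have h2 := h k x
    have h3 : (0 : ℝ) ≤ if x = k then 1 else 0 := by split_ifs <;> norm_num
    linarith
  have h4 := h k k
  rw [mulVec_const hp (eq_of_mulVec_le hp hirr h1)] at h4
  simp only [if_true, sub_self, add_zero] at h4
  linarith

end Poisson

/-! ### The block Markov chain -/

section Block

variable {V C : Type*} [Fintype V] [Fintype C] [DecidableEq C] {p : Matrix C C ℝ} {σ : V → C}

/-- The size of a cluster. -/
def clusterSize (σ : V → C) (k : C) : ℕ := (Finset.univ.filter fun v => σ v = k).card

omit [Fintype C] in
theorem blockTransition_apply (x y : V) :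
    blockTransition p σ x y = p (σ x) (σ y) / (clusterSize σ (σ y) : ℝ) := rfl

omit [Fintype C] in
theorem clusterSize_pos (hσ : Function.Surjective σ) (k : C) : (0 : ℝ) < clusterSize σ k := by
  obtain ⟨v, hv⟩ := hσ k
  exact_mod_cast Finset.card_pos.mpr ⟨v, by simp [hv]⟩

theorem sum_div_clusterSize (hσ : Function.Surjective σ) (φ : C → ℝ) :
    ∑ v, φ (σ v) / (clusterSize σ (σ v) : ℝ) = ∑ k, φ k := by
  rw [← Finset.sum_fiberwise Finset.univ σ]
  refine Finset.sum_congr rfl fun k _ => ?_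
  rw [Finset.sum_congr rfl fun v hv => by rw [(Finset.mem_filter.mp hv).2], Finset.sum_const,
    nsmul_eq_mul]
  exact mul_div_cancel₀ _ (clusterSize_pos hσ k).ne'

/-- Lumpability: on functions of the cluster, the block chain acts as `p`. -/
theorem sum_blockTransition_mul (hσ : Function.Surjective σ) (φ : C → ℝ) (x : V) :
    ∑ y, blockTransition p σ x y * φ (σ y) = (p *ᵥ φ) (σ x) := by
  rw [Matrix.mulVec, dotProduct, ← sum_div_clusterSize hσ]
  exact Finset.sum_congr rfl fun y _ => by rw [blockTransition_apply]; ring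

theorem blockTransition_nonneg (hp : p ∈ Matrix.rowStochastic ℝ C) (x y : V) :
    0 ≤ blockTransition p σ x y :=
  div_nonneg (Matrix.nonneg_of_mem_rowStochastic hp) (Nat.cast_nonneg _)

theorem sum_blockTransition (hp : p ∈ Matrix.rowStochastic ℝ C) (hσ : Function.Surjective σ)
    (x : V) : ∑ y, blockTransition p σ x y = 1 := by
  have := sum_blockTransition_mul (p := p) hσ (fun _ => 1) x
  simp only [mul_one] at this
  rw [this, mulVec_const hp fun _ _ => rfl]

theorem blockTransition_le (hp : p ∈ Matrix.rowStochastic ℝ C) (x y : V) :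
    blockTransition p σ x y ≤ 1 / (clusterSize σ (σ y) : ℝ) := by
  rw [blockTransition_apply]
  gcongr
  exact Matrix.le_one_of_mem_rowStochastic hp

variable {c : C → ℝ} {g : C → C → ℝ}

/-- Pairing `q` with the lifted Poisson equation cancels `g - p g` by invariance and leaves `c k` as
the mass of cluster `k`. Within a cluster `q` is constant, because the columns of the transition
matrix are. -/
theorem IsEquilibrium.apply_eq (hσ : Function.Surjective σ)
    (hg : ∀ k x, (if x = k then 1 else 0) = c k + (g k x - (p *ᵥ g k) x))
    {q : V → ℝ} (hq : IsEquilibrium (blockTransition p σ) q) (v : V) :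
    q v = c (σ v) / clusterSize σ (σ v) := by
  have hN := clusterSize_pos hσ (σ v)
  have hqP : ∀ φ : V → ℝ, ∑ x, q x * ∑ y, blockTransition p σ x y * φ y = ∑ x, q x * φ x := by
    intro φ
    have := congrArg (fun r => r ⬝ᵥ φ) hq.2
    simp only [← Matrix.dotProduct_mulVec] at this
    exact this
  have h1 : ∀ y, q y = (∑ x, q x * p (σ x) (σ y)) / clusterSize σ (σ y) := by
    intro y
    conv_lhs => rw [← hq.2]
    simp only [Matrix.vecMul, dotProduct, blockTransition_apply, Finset.sum_div, mul_div_assoc]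
  have h2 : ∑ x, q x * (if σ x = σ v then 1 else 0) = c (σ v) := by
    have h3 := hqP fun y => g (σ v) (σ y)
    simp only [sum_blockTransition_mul hσ] at h3
    simp only [hg, mul_add, mul_sub, Finset.sum_add_distrib, Finset.sum_sub_distrib,
      ← Finset.sum_mul, hq.1.2, h3]
    ring
  have h4 : ∑ x, q x * (if σ x = σ v then 1 else 0) = clusterSize σ (σ v) * q v := by
    simp only [mul_ite, mul_one, mul_zero, ← Finset.sum_filter]
    rw [Finset.sum_congr rfl fun x hx => by rw [h1 x, (Finset.mem_filter.mp hx).2, ← h1 v],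
      Finset.sum_const, nsmul_eq_mul]
    rfl
  rw [← h2, h4, mul_div_cancel_left₀ _ hN.ne']

variable [DecidableEq V]

/-- The variance bound for the number of visits to a state. -/
theorem pathMean_visits_sq_le {ℓ : ℕ} (hp : p ∈ Matrix.rowStochastic ℝ C)
    (hσ : Function.Surjective σ)
    (hg : ∀ k x, (if x = k then 1 else 0) = c k + (g k x - (p *ᵥ g k) x)) {B : ℝ}
    (hB : ∀ k x, |g k x| ≤ B) {q ι : V → ℝ} (hq : IsEquilibrium (blockTransition p σ) q)
    (hι : ι ∈ stdSimplex ℝ V) (i : V) :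
    pathMean ι (blockTransition p σ)
        (fun z : Fin (ℓ + 1) → V => (∑ k, freqMatrix z i k - ℓ * q i) ^ 2) ≤
      (4 + 4 * (ℓ / clusterSize σ (σ i))) * (B + 2) ^ 2 := by
  set k := σ i with hk
  set N : ℝ := (clusterSize σ k : ℝ) with hN
  have hN0 : 0 < N := clusterSize_pos hσ k
  have hN1 : 1 ≤ N := Nat.one_le_cast.mpr (Nat.cast_pos.mp hN0)
  let f : C → ℝ := fun x => g k x - if x = k then 1 else 0
  have hf : ∀ x, |f x| ≤ B + 1 := by
    intro x
    refine (abs_sub _ _).trans (add_le_add (hB k x) ?_)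
    split_ifs <;> simp
  have hB0 : 0 ≤ B := (abs_nonneg _).trans (hB k k)
  have hpf : ∀ x, (p *ᵥ f) x = (p *ᵥ g k) x - p x k := by
    intro x
    simp [f, Matrix.mulVec, dotProduct, mul_sub, Finset.sum_sub_distrib]
  -- This solves the Poisson equation for `u`. The indicator subtracted in `f` offsets the term `p
  -- (σ x) k / N` that the point mass at `i` produces after one step.
  let G : V → ℝ := fun x => (if x = i then 1 else 0) + f (σ x) / N
  let u : V → ℝ := fun x => (if x = i then 1 else 0) - q i
  have hG : ∀ x, G x = u x + ∑ y, blockTransition p σ x y * G y := by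
    intro x
    have h1 : ∑ y, blockTransition p σ x y * G y = p (σ x) k / N + (p *ᵥ f) (σ x) / N := by
      simp only [G, mul_add, Finset.sum_add_distrib, mul_ite, mul_one, mul_zero,
        Finset.sum_ite_eq', Finset.mem_univ, if_true, ← mul_div_assoc, ← Finset.sum_div,
        sum_blockTransition_mul hσ]
      rw [blockTransition_apply]
    rw [h1, hpf]
    simp only [G, u, f]
    rw [hq.apply_eq hσ hg i, ← hk, ← hN, hg k (σ x)]
    ring
  have hG2 : ∀ x, G x ^ 2 ≤ (B + 2) ^ 2 := by
    intro x
    rw [sq_le_sq, abs_of_nonneg (show 0 ≤ B + 2 by linarith)]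
    refine (abs_add_le _ _).trans ?_
    have h1 : |if x = i then (1 : ℝ) else 0| ≤ 1 := by split_ifs <;> simp
    have h2 : |f (σ x) / N| ≤ B + 1 := by
      rw [abs_div, abs_of_pos hN0]
      exact (div_le_self (abs_nonneg _) hN1).trans (hf _)
    linarith
  -- `G` is of order 1 only at `i`, which is hit with probability at most `1 / N`, and of order `1 /
  -- N` elsewhere; hence variance `O(1 / N)` per step.
  have hv : ∀ x, ∑ y, blockTransition p σ x y * G y ^ 2 ≤ 2 / N * (B + 2) ^ 2 := by
    intro x
    have h1 : ∀ y, G y ^ 2 ≤ 2 * (if y = i then 1 else 0) + 2 * ((B + 1) ^ 2 / N) := by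
      intro y
      have h2 : (f (σ y) / N) ^ 2 ≤ (B + 1) ^ 2 / N := by
        rw [div_pow]
        have h3 : f (σ y) ^ 2 ≤ (B + 1) ^ 2 := by
          rw [sq_le_sq, abs_of_nonneg (show 0 ≤ B + 1 by linarith)]
          exact hf _
        calc f (σ y) ^ 2 / N ^ 2 ≤ (B + 1) ^ 2 / N ^ 2 := by gcongr
          _ ≤ (B + 1) ^ 2 / N := by
            gcongr
            nlinarith
      simp only [G]
      split_ifs
      · nlinarith [sq_nonneg (1 - f (σ y) / N)]
      · have : 0 ≤ (B + 1) ^ 2 / N := by positivity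
        simp only [zero_add, mul_zero]
        linarith
    calc ∑ y, blockTransition p σ x y * G y ^ 2
        ≤ ∑ y, blockTransition p σ x y *
            (2 * (if y = i then 1 else 0) + 2 * ((B + 1) ^ 2 / N)) :=
          Finset.sum_le_sum fun y _ =>
            mul_le_mul_of_nonneg_left (h1 y) (blockTransition_nonneg hp x y)
      _ = 2 * blockTransition p σ x i + 2 * ((B + 1) ^ 2 / N) := by
          simp only [mul_add, Finset.sum_add_distrib, ← Finset.sum_mul,
            sum_blockTransition hp hσ, one_mul, mul_ite, mul_one, mul_zero, Finset.sum_ite_eq',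
            Finset.mem_univ, if_true]
          ring
      _ ≤ 2 * (1 / N) + 2 * ((B + 1) ^ 2 / N) := by
          gcongr
          exact blockTransition_le hp x i
      _ = 2 / N * (1 + (B + 1) ^ 2) := by ring
      _ ≤ 2 / N * (B + 2) ^ 2 := by
          gcongr
          nlinarith
  have h := pathMean_sq_le (ℓ := ℓ) (blockTransition_nonneg hp) (sum_blockTransition hp hσ) hG hv
    hG2 hι.1 hι.2
  have hu : ∀ z : Fin (ℓ + 1) → V,
      ∑ k, freqMatrix z i k - ℓ * q i = ∑ t : Fin ℓ, u (z t.castSucc) := by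
    intro z
    rw [sum_freqMatrix]
    simp [u, Finset.sum_sub_distrib]
  simp only [hu]
  refine h.trans (le_of_eq ?_)
  ring

end Block

/-! ### Transfer of convergence between sample paths -/

/-- Weak convergence in probability of singular value distributions is transferred from functions of
the path `X` to functions of the path `Y`, if the law of `Y` after time `0` is dominated by that of
`X`, and the matrices are comparable for paths that agree after time `0`. -/
theorem ConvergesWeaklyInProbability.transfer {ℓ : ℕ → ℕ}
    {ΩX : ℕ → Type*} [∀ n, MeasurableSpace (ΩX n)] {μX : ∀ n, Measure (ΩX n)}
    {X : ∀ n : ℕ, Fin (ℓ n + 1) → ΩX n → Fin n}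
    {ΩY : ℕ → Type*} [∀ n, MeasurableSpace (ΩY n)] {μY : ∀ n, Measure (ΩY n)}
    {Y : ∀ n : ℕ, Fin (ℓ n + 1) → ΩY n → Fin n}
    {a b : ∀ n : ℕ, (Fin (ℓ n + 1) → Fin n) → Matrix (Fin n) (Fin n) ℝ}
    {C : ENNReal} (hC : C ≠ ⊤)
    (hdom : ∀ᶠ n in atTop, ∀ S : Set (Fin (ℓ n) → Fin n),
      μY n {ω | (fun t : Fin (ℓ n) => Y n t.succ ω) ∈ S} ≤
        C * μX n {ω | (fun t : Fin (ℓ n) => X n t.succ ω) ∈ S})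
    {bad : ℝ → ∀ n : ℕ, Set (Fin (ℓ n + 1) → Fin n)}
    (hbad : ∀ δ : ℝ, 0 < δ →
      Tendsto (fun n => μY n {ω | (fun t => Y n t ω) ∈ bad δ n}) atTop (𝓝 0))
    (hcomp : ∀ δ : ℝ, 0 < δ → ∀ᶠ n in atTop, ∀ x y : Fin (ℓ n + 1) → Fin n,
      (∀ t : Fin (ℓ n), x t.succ = y t.succ) → y ∉ bad δ n →
        ∃ r : ℕ, (r : ℝ) ≤ δ * n ∧ Comparable δ r (a n x) (b n y))
    {ν : Measure ℝ} [IsProbabilityMeasure ν]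
    (hconv : ConvergesWeaklyInProbability μX
      (fun n ω => singularDist (a n fun t => X n t ω)) ν) :
    ConvergesWeaklyInProbability μY (fun n ω => singularDist (b n fun t => Y n t ω)) ν := by
  intro f ε hε
  obtain ⟨h, χ, δ, hδ, H⟩ := exists_testFunctions ν f hε
  have hlim := (hbad δ hδ).add
    (ENNReal.Tendsto.const_mul ((hconv h δ hδ).add (hconv χ δ hδ)) (Or.inr hC))
  simp only [add_zero, mul_zero] at hlim
  refine tendsto_of_tendsto_of_tendsto_of_le_of_le' tendsto_const_nhds hlim
    (Eventually.of_forall fun _ => zero_le) ?_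
  filter_upwards [hdom, hcomp δ hδ, eventually_gt_atTop 0] with n hn hc hn0
  -- Quantifying over all initial states makes `S` an event of the path after time 0. An atypical
  -- `Y` outside `bad` lands in it, and a path of `X` in it is atypical, being one of the
  -- extensions.
  let S : Set (Fin (ℓ n) → Fin n) := {w | ∀ x : Fin (ℓ n + 1) → Fin n,
    (∀ t : Fin (ℓ n), x t.succ = w t) →
      δ < |∫ s, h s ∂(singularDist (a n x)) - ∫ s, h s ∂ν| ∨
        δ < |∫ s, χ s ∂(singularDist (a n x)) - ∫ s, χ s ∂ν|}
  have hY : {ω | ε < |∫ s, f s ∂(singularDist (b n fun t => Y n t ω)) - ∫ s, f s ∂ν|} ⊆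
      {ω | (fun t => Y n t ω) ∈ bad δ n} ∪ {ω | (fun t : Fin (ℓ n) => Y n t.succ ω) ∈ S} := by
    intro ω hω
    by_contra hcon
    simp only [Set.mem_union, Set.mem_ofPred_eq, not_or] at hcon
    obtain ⟨h1, h2⟩ := hcon
    apply h2
    intro x hx
    by_contra! h3
    obtain ⟨r, hr, hr'⟩ := hc x (fun t => Y n t ω) hx h1
    exact absurd (H n r _ _ hn0 hr hr' h3.1 h3.2) (not_le.mpr hω)
  have hX : {ω | (fun t : Fin (ℓ n) => X n t.succ ω) ∈ S} ⊆
      {ω | δ < |∫ s, h s ∂(singularDist (a n fun t => X n t ω)) - ∫ s, h s ∂ν|} ∪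
        {ω | δ < |∫ s, χ s ∂(singularDist (a n fun t => X n t ω)) - ∫ s, χ s ∂ν|} :=
    fun ω hω => hω (fun t => X n t ω) fun _ => rfl
  refine (measure_mono hY).trans ((measure_union_le _ _).trans ?_)
  gcongr
  refine (hn S).trans ?_
  gcongr
  exact (measure_mono hX).trans (measure_union_le _ _)

/-! ### Comparable matrices -/

theorem exists_submodule_dotProduct_eq_zero {n : ℕ} {κ : Type*} [Fintype κ]
    (a : κ → Fin n → ℝ) :
    ∃ U : Submodule ℝ (EuclideanSpace ℝ (Fin n)),
      n ≤ Module.finrank ℝ U + Fintype.card κ ∧ ∀ v ∈ U, ∀ k, a k ⬝ᵥ v.ofLp = 0 := by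
  obtain ⟨U, hU, h⟩ := exists_submodule_forall_eq_zero
    (E := EuclideanSpace ℝ (Fin n)) fun k : κ => (Fintype.linearCombination ℝ (a k)).comp
      (WithLp.linearEquiv 2 ℝ (Fin n → ℝ)).toLinearMap
  refine ⟨U, by simpa using hU, fun v hv k => ?_⟩
  rw [← h v hv k]
  simp [Fintype.linearCombination_apply, dotProduct, mul_comm]

theorem norm_toEuclideanLin_le {n : ℕ} {A B : Matrix (Fin n) (Fin n) ℝ} {c : ℝ} (hc : 0 ≤ c)
    (v : EuclideanSpace ℝ (Fin n)) (h : ∀ i, |(A *ᵥ v.ofLp) i| ≤ c * |(B *ᵥ v.ofLp) i|) :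
    ‖Matrix.toEuclideanLin A v‖ ≤ c * ‖Matrix.toEuclideanLin B v‖ := by
  refine le_of_sq_le_sq ?_ (by positivity)
  rw [mul_pow, EuclideanSpace.real_norm_sq_eq, EuclideanSpace.real_norm_sq_eq, Finset.mul_sum]
  refine Finset.sum_le_sum fun i _ => ?_
  rw [← sq_abs, ← sq_abs ((Matrix.toEuclideanLin B v) i), ← mul_pow]
  exact pow_le_pow_left₀ (abs_nonneg _) (h i) 2

theorem comparable_of_forall_abs_le {n r : ℕ} {δ : ℝ} (hδ : 0 ≤ δ)
    {A B : Matrix (Fin n) (Fin n) ℝ} {U : Submodule ℝ (EuclideanSpace ℝ (Fin n))}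
    (hU : n ≤ Module.finrank ℝ U + r)
    (h : ∀ v ∈ U, ∀ i, |(A *ᵥ v.ofLp) i| ≤ (1 + δ) * |(B *ᵥ v.ofLp) i| ∧
      |(B *ᵥ v.ofLp) i| ≤ (1 + δ) * |(A *ᵥ v.ofLp) i|) :
    Comparable δ r A B :=
  ⟨U, hU, fun v hv => ⟨norm_toEuclideanLin_le (by positivity) v fun i => (h v hv i).1,
    norm_toEuclideanLin_le (by positivity) v fun i => (h v hv i).2⟩⟩

/-- Off a subspace of small codimension, a shift of the transition counts by a matrix that is
constant along clusters and a change of the initial state are invisible, and finitely many rows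
vanish. -/
theorem exists_submodule_freqMatrix {n ℓ : ℕ} {C : Type*} [Fintype C] [DecidableEq C]
    (hℓ : 0 < ℓ) (σ : Fin n → C) {E : Matrix (Fin n) (Fin n) ℝ} (w : Fin n → C → ℝ)
    (hE : ∀ i j, E i j = w i (σ j)) {x y : Fin (ℓ + 1) → Fin n}
    (hxy : ∀ t : Fin ℓ, x t.succ = y t.succ) (s : Finset (Fin n)) :
    ∃ U : Submodule ℝ (EuclideanSpace ℝ (Fin n)),
      n ≤ Module.finrank ℝ U + (Fintype.card C + 1 + s.card) ∧
      ∀ v ∈ U, (freqMatrix x - E) *ᵥ v.ofLp = freqMatrix y *ᵥ v.ofLp ∧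
        ∀ i ∈ s, (freqMatrix y *ᵥ v.ofLp) i = 0 := by
  obtain ⟨m, rfl⟩ : ∃ m, ℓ = m + 1 := ⟨ℓ - 1, by omega⟩
  -- The conditions are: zero cluster sums, to kill `E`; zero value at `y 1`, to hide the first
  -- transition; orthogonality to the rows in `s`.
  obtain ⟨U, hU, h⟩ := exists_submodule_dotProduct_eq_zero
    (Sum.elim (fun (k : C) (j : Fin n) => if σ j = k then (1 : ℝ) else 0)
      (Sum.elim (fun _ : Unit => Pi.single (y 1) 1) fun i : s => freqMatrix y i))
  refine ⟨U, ?_, fun v hv => ⟨?_, fun i hi => h v hv (Sum.inr (Sum.inr ⟨i, hi⟩))⟩⟩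
  · simpa [add_assoc] using hU
  · have h1 : v.ofLp (y 1) = 0 := by
      simpa using h v hv (Sum.inr (Sum.inl ()))
    have h2 : E *ᵥ v.ofLp = 0 := by
      ext i
      have h3 : ∀ k, ∑ j, (if σ j = k then v.ofLp j else 0) = 0 := by
        intro k
        simpa [dotProduct] using h v hv (Sum.inl k)
      calc (E *ᵥ v.ofLp) i = ∑ j, ∑ k, w i k * (if σ j = k then v.ofLp j else 0) := by
            simp [Matrix.mulVec, dotProduct, hE]
        _ = ∑ k, w i k * ∑ j, (if σ j = k then v.ofLp j else 0) := by
            rw [Finset.sum_comm]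
            simp only [Finset.mul_sum]
        _ = 0 := by simp [h3]
    rw [Matrix.sub_mulVec, h2, sub_zero, freqMatrix_mulVec_eq_of_tail_eq hxy h1]

theorem empTransition_mulVec {V : Type*} [Fintype V] [DecidableEq V] {ℓ : ℕ}
    (z : Fin (ℓ + 1) → V) (v : V → ℝ) (i : V) :
    (empTransition z *ᵥ v) i = (freqMatrix z *ᵥ v) i / ∑ k, freqMatrix z i k := by
  simp only [Matrix.mulVec, dotProduct, empTransition, Matrix.of_apply, Finset.sum_div,
    div_mul_eq_mul_div]

theorem inv_diagonal_mul_mulVec {V : Type*} [Fintype V] [DecidableEq V] {d : V → ℝ}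
    (hd : ∀ i, d i ≠ 0) (M : Matrix V V ℝ) (v : V → ℝ) (i : V) :
    (((Matrix.diagonal d)⁻¹ * M) *ᵥ v) i = (M *ᵥ v) i / d i := by
  have : (Matrix.diagonal d)⁻¹ = Matrix.diagonal fun i => (d i)⁻¹ := by
    refine Matrix.inv_eq_left_inv ?_
    rw [Matrix.diagonal_mul_diagonal, ← Matrix.diagonal_one]
    congr 1
    ext i
    exact inv_mul_cancel₀ (hd i)
  rw [this, ← Matrix.mulVec_mulVec, Matrix.mulVec_diagonal, div_eq_inv_mul]

theorem comparable_freqMatrix {n ℓ : ℕ} {C : Type*} [Fintype C] [DecidableEq C]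
    (hℓ : 0 < ℓ) (σ : Fin n → C) {E : Matrix (Fin n) (Fin n) ℝ} (w : Fin n → C → ℝ)
    (hE : ∀ i j, E i j = w i (σ j)) {x y : Fin (ℓ + 1) → Fin n}
    (hxy : ∀ t : Fin ℓ, x t.succ = y t.succ) {δ : ℝ} (hδ : 0 ≤ δ) (c : ℝ) :
    Comparable δ (Fintype.card C + 1) (c • (freqMatrix x - E)) (c • freqMatrix y) := by
  obtain ⟨U, hU, h⟩ := exists_submodule_freqMatrix hℓ σ w hE hxy ∅
  refine comparable_of_forall_abs_le hδ (by simpa using hU) fun v hv i => ?_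
  rw [Matrix.smul_mulVec, Matrix.smul_mulVec, (h v hv).1]
  have : 0 ≤ δ * |(c • freqMatrix y *ᵥ v.ofLp) i| := by positivity
  constructor <;> linarith

/-- Rows whose sum is far from `d i` are annihilated; elsewhere the two denominators agree up to `1
+ δ`. Empty rows, with the convention `0 / 0 = 0`, are among the annihilated ones when they occur,
since their deviation is `d i`. -/
theorem comparable_empTransition {n ℓ : ℕ} {C : Type*} [Fintype C] [DecidableEq C]
    (hℓ : 0 < ℓ) (σ : Fin n → C) {E : Matrix (Fin n) (Fin n) ℝ} (w : Fin n → C → ℝ)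
    (hE : ∀ i j, E i j = w i (σ j)) {x y : Fin (ℓ + 1) → Fin n}
    (hxy : ∀ t : Fin ℓ, x t.succ = y t.succ) {δ : ℝ} (hδ : 0 ≤ δ) (c : ℝ) {d : Fin n → ℝ}
    (hd : ∀ i, 0 < d i) :
    Comparable δ (Fintype.card C + 1 +
        (Finset.univ.filter fun i => δ / (1 + δ) * d i < |∑ k, freqMatrix y i k - d i|).card)
      (c • ((Matrix.diagonal d)⁻¹ * (freqMatrix x - E))) (c • empTransition y) := by
  obtain ⟨U, hU, h⟩ := exists_submodule_freqMatrix hℓ σ w hE hxy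
    (Finset.univ.filter fun i => δ / (1 + δ) * d i < |∑ k, freqMatrix y i k - d i|)
  refine comparable_of_forall_abs_le hδ hU fun v hv i => ?_
  obtain ⟨h1, h2⟩ := h v hv
  rw [Matrix.smul_mulVec, Matrix.smul_mulVec, Pi.smul_apply, Pi.smul_apply,
    inv_diagonal_mul_mulVec (fun i => (hd i).ne'), empTransition_mulVec, h1]
  rcases lt_or_ge (δ / (1 + δ) * d i) |∑ k, freqMatrix y i k - d i| with hi | hi
  · rw [h2 i (Finset.mem_filter.mpr ⟨Finset.mem_univ i, hi⟩)]
    simp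
  · have hdi := hd i
    set D := ∑ k, freqMatrix y i k
    set u := (freqMatrix y *ᵥ v.ofLp) i
    -- The threshold is chosen so that the lower end of the allowed range is exactly `d i / (1 +
    -- δ)`.
    have h3 : δ / (1 + δ) * d i = d i - d i / (1 + δ) := by
      field_simp
      ring
    have h4 : δ / (1 + δ) * d i ≤ δ * d i := by
      gcongr
      exact div_le_self hδ (by linarith)
    rw [abs_le] at hi
    have h5 : d i / (1 + δ) ≤ D := by linarith
    have h6 : D ≤ (1 + δ) * d i := by linarith
    have hD : 0 < D := lt_of_lt_of_le (by positivity) h5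
    have h7 : d i ≤ (1 + δ) * D := by
      rw [div_le_iff₀ (by positivity)] at h5
      linarith
    have key : ∀ {s t : ℝ}, 0 < s → 0 < t → t ≤ (1 + δ) * s →
        |c • (u / s)| ≤ (1 + δ) * |c • (u / t)| := by
      intro s t hs ht hst
      rw [smul_eq_mul, smul_eq_mul, abs_mul, abs_mul, abs_div, abs_div, abs_of_pos hs,
        abs_of_pos ht, mul_left_comm]
      gcongr
      rw [div_le_iff₀ hs, mul_div_assoc', div_mul_eq_mul_div, le_div_iff₀ ht]
      calc |u| * t ≤ |u| * ((1 + δ) * s) := by gcongr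
        _ = (1 + δ) * |u| * s := by ring
    exact ⟨key hdi hD h6, key hD hdi h7⟩

/-- Chebyshev bound for the number of indices with a large deviation. -/
theorem pathMean_indicator_card_le {V κ : Type*} [Fintype V] [Fintype κ] {ℓ : ℕ} {ι : V → ℝ}
    {P : Matrix V V ℝ} (hι : ∀ x, 0 ≤ ι x) (hP : ∀ x y, 0 ≤ P x y)
    (F : κ → (Fin (ℓ + 1) → V) → ℝ) (τ : κ → ℝ) {s θ B : ℝ} (hs : 0 < s) (hθ : 0 < θ)
    (hτ : ∀ i, s ≤ τ i) (hB : ∀ i, pathMean ι P (fun z => F i z ^ 2) ≤ B) :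
    pathMean ι P ({z | θ < ((Finset.univ.filter fun i => τ i < |F i z|).card : ℝ)}.indicator 1) ≤
      (θ * s ^ 2)⁻¹ * (Fintype.card κ * B) := by
  calc _ ≤ pathMean ι P (fun z => (θ * s ^ 2)⁻¹ * ∑ i, F i z ^ 2) := by
        refine pathMean_mono hι hP fun z => ?_
        have h0 : 0 ≤ ∑ i, F i z ^ 2 := Finset.sum_nonneg fun i _ => sq_nonneg _
        refine Set.indicator_apply_le' (fun hz => ?_) fun _ => by positivity
        rw [Pi.one_apply, inv_mul_eq_div, one_le_div (by positivity)]
        calc θ * s ^ 2 ≤ ((Finset.univ.filter fun i => τ i < |F i z|).card : ℝ) * s ^ 2 := by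
              gcongr
              exact le_of_lt hz
          _ = ∑ i ∈ Finset.univ.filter (fun i => τ i < |F i z|), s ^ 2 := by simp
          _ ≤ ∑ i ∈ Finset.univ.filter (fun i => τ i < |F i z|), F i z ^ 2 := by
              refine Finset.sum_le_sum fun i hi => ?_
              rw [← sq_abs (F i z)]
              have := (hτ i).trans (Finset.mem_filter.mp hi).2.le
              gcongr
          _ ≤ ∑ i, F i z ^ 2 :=
              Finset.sum_le_sum_of_subset_of_nonneg (Finset.filter_subset _ _)
                fun i _ _ => sq_nonneg _
    _ = (θ * s ^ 2)⁻¹ * ∑ i, pathMean ι P (fun z => F i z ^ 2) := by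
        rw [pathMean_const_mul, pathMean_sum]
    _ ≤ (θ * s ^ 2)⁻¹ * (Fintype.card κ * B) := by
        gcongr
        simpa using Finset.sum_le_card_nsmul Finset.univ _ B fun i _ => hB i

/-! ### Asymptotics -/

theorem eventually_mul_le_clusterSize {C : Type*} [Fintype C] [Nonempty C] [DecidableEq C]
    {σ : ∀ n : ℕ, Fin n → C} {α : C → ℝ} (hα_pos : ∀ k, 0 < α k)
    (hα : ∀ k, (fun n : ℕ => (clusterSize (σ n) k : ℝ) - α k * (n : ℝ))
      =o[atTop] fun n : ℕ => (n : ℝ)) :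
    ∃ A : ℝ, 0 < A ∧ ∀ᶠ n : ℕ in atTop, ∀ k, A * n ≤ clusterSize (σ n) k := by
  obtain ⟨k₀, hk₀⟩ := Finite.exists_min α
  refine ⟨α k₀ / 2, half_pos (hα_pos k₀), eventually_all.mpr fun k => ?_⟩
  filter_upwards [(hα k).bound (half_pos (hα_pos k₀))] with n hn
  rw [Real.norm_eq_abs, Real.norm_of_nonneg (Nat.cast_nonneg n), abs_le] at hn
  have := mul_le_mul_of_nonneg_right (hk₀ k) (Nat.cast_nonneg (α := ℝ) n)
  linarith

theorem eventually_length_bounds {lam : ℝ} (hlam : 0 < lam) {ℓ : ℕ → ℕ}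
    (hℓ : (fun n : ℕ => (ℓ n : ℝ) - lam * (n : ℝ) ^ 2) =o[atTop] fun n : ℕ => (n : ℝ) ^ 2) :
    ∀ᶠ n : ℕ in atTop, lam / 2 * (n : ℝ) ^ 2 ≤ ℓ n ∧ (ℓ n : ℝ) ≤ 2 * lam * (n : ℝ) ^ 2 := by
  filter_upwards [hℓ.bound (half_pos hlam)] with n hn
  have h2 : (0 : ℝ) ≤ (n : ℝ) ^ 2 := by positivity
  rw [Real.norm_eq_abs, Real.norm_of_nonneg h2, abs_le] at hn
  have := mul_nonneg hlam.le h2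
  constructor <;> linarith

/-- In most rows, the number of visits of a block Markov chain is close to its mean. -/
theorem tendsto_measure_card_deviation {C : Type*} [Fintype C] [Nonempty C] [DecidableEq C]
    {p : Matrix C C ℝ} (hp : p ∈ Matrix.rowStochastic ℝ C) {σ : ∀ n : ℕ, Fin n → C}
    (hσ : ∀ᶠ n in atTop, Function.Surjective (σ n))
    {A : ℝ} (hA : 0 < A) (hAσ : ∀ᶠ n : ℕ in atTop, ∀ k, A * n ≤ clusterSize (σ n) k)
    {lam : ℝ} (hlam : 0 < lam) {ℓ : ℕ → ℕ}
    (hℓ : ∀ᶠ n : ℕ in atTop,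
      lam / 2 * (n : ℝ) ^ 2 ≤ ℓ n ∧ (ℓ n : ℝ) ≤ 2 * lam * (n : ℝ) ^ 2)
    {c : C → ℝ} {g : C → C → ℝ} (hc : ∀ k, 0 < c k)
    (hg : ∀ k x, (if x = k then 1 else 0) = c k + (g k x - (p *ᵥ g k) x))
    {q : ∀ n : ℕ, Fin n → ℝ}
    (hq : ∀ᶠ n in atTop, IsEquilibrium (blockTransition p (σ n)) (q n))
    {ι : ∀ n : ℕ, Fin n → ℝ} (hι : ∀ᶠ n in atTop, ι n ∈ stdSimplex ℝ (Fin n))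
    {Ω : ℕ → Type*} [∀ n, MeasurableSpace (Ω n)] {μ : ∀ n, Measure (Ω n)}
    {Y : ∀ n : ℕ, Fin (ℓ n + 1) → Ω n → Fin n}
    (hY : ∀ᶠ n in atTop, IsSamplePath (μ n) (ι n) (blockTransition p (σ n)) (Y n))
    {β θ : ℝ} (hβ : 0 < β) (hθ : 0 < θ) :
    Tendsto (fun n => μ n {ω | θ * n < ((Finset.univ.filter fun i =>
        β * ((ℓ n + 1) * q n i) <
          |∑ k, freqMatrix (fun t => Y n t ω) i k - (ℓ n + 1) * q n i|).card : ℝ)})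
      atTop (𝓝 0) := by
  obtain ⟨k₀, hk₀⟩ := Finite.exists_min c
  obtain ⟨kk, hB'⟩ := Finite.exists_max fun k : C × C => |g k.1 k.2|
  set B := |g kk.1 kk.2|
  have hB : ∀ k x, |g k x| ≤ B := fun k x => hB' (k, x)
  have hc₀ := hc k₀
  set s := β * (lam / 2 * c k₀) with hs
  have hs0 : 0 < s := by positivity
  -- Twice the variance bound with `ℓ / clusterSize ≤ 2 * lam / A * n`, plus 2 for centring at `(ℓ +
  -- 1) * q` instead of `ℓ * q`; constants are absorbed into multiples of `n`.
  set D := 2 * ((4 + 4 * (2 * lam / A)) * (B + 2) ^ 2) + 2 with hD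
  have hlim : Tendsto (fun n : ℕ => ENNReal.ofReal (D / (θ * s ^ 2) / n)) atTop (𝓝 0) := by
    rw [← ENNReal.ofReal_zero]
    exact ENNReal.tendsto_ofReal (tendsto_const_div_atTop_nhds_zero_nat _)
  refine tendsto_of_tendsto_of_tendsto_of_le_of_le' tendsto_const_nhds hlim
    (Eventually.of_forall fun _ => zero_le) ?_
  filter_upwards [hσ, hAσ, hℓ, hq, hι, hY, eventually_gt_atTop 0] with
    n hσ hAσ hℓ hq hι hY hn
  have hn0 : (0 : ℝ) < n := by exact_mod_cast hn
  have hn1 : (1 : ℝ) ≤ n := by exact_mod_cast hn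
  have hP := blockTransition_nonneg (σ := σ n) hp
  have hqle : ∀ i, q n i ≤ 1 := fun i =>
    (Finset.single_le_sum (fun j _ => hq.1.1 j) (Finset.mem_univ i)).trans_eq hq.1.2
  have hτ : ∀ i, s * n ≤ β * ((ℓ n + 1) * q n i) := by
    intro i
    have h1 : (clusterSize (σ n) (σ n i) : ℝ) ≤ n := by
      exact_mod_cast (Finset.card_filter_le _ _).trans (by simp)
    have h2 := clusterSize_pos hσ (σ n i)
    have h3 : c k₀ / n ≤ q n i := by
      rw [hq.apply_eq hσ hg i]
      have := (hc (σ n i)).le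
      gcongr
      exact hk₀ _
    calc s * n = β * ((lam / 2 * (n : ℝ) ^ 2) * (c k₀ / n)) := by
          rw [hs]
          field_simp
      _ ≤ β * ((ℓ n + 1) * q n i) := by
          gcongr
          linarith [hℓ.1]
  have hmean : ∀ i, pathMean (ι n) (blockTransition p (σ n))
      (fun z : Fin (ℓ n + 1) → Fin n =>
        (∑ k, freqMatrix z i k - (ℓ n + 1) * q n i) ^ 2) ≤ D * n := by
    intro i
    have hN : (ℓ n : ℝ) / clusterSize (σ n) (σ n i) ≤ 2 * lam / A * n := by
      rw [div_le_iff₀ (clusterSize_pos hσ _)]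
      calc (ℓ n : ℝ) ≤ 2 * lam * (n : ℝ) ^ 2 := hℓ.2
        _ = 2 * lam / A * n * (A * n) := by field_simp
        _ ≤ _ := by
          gcongr
          exact hAσ _
    calc _ ≤ pathMean (ι n) (blockTransition p (σ n)) (fun z : Fin (ℓ n + 1) → Fin n =>
          2 * (∑ k, freqMatrix z i k - ℓ n * q n i) ^ 2 + 2) := by
          refine pathMean_mono hι.1 hP fun z => ?_
          have h1 := hqle i
          have h2 := hq.1.1 i
          nlinarith [sq_nonneg (∑ k, freqMatrix z i k - ℓ n * q n i + q n i)]
      _ ≤ 2 * ((4 + 4 * (2 * lam / A * n)) * (B + 2) ^ 2) + 2 := by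
          rw [pathMean_add, pathMean_const_mul, pathMean_const hι.2 (sum_blockTransition hp hσ)]
          gcongr
          refine (pathMean_visits_sq_le hp hσ hg hB hq hι i).trans ?_
          gcongr
      _ ≤ 2 * ((4 * n + 4 * (2 * lam / A * n)) * (B + 2) ^ 2) + 2 * n := by
          gcongr <;> linarith
      _ = D * n := by
          rw [hD]
          ring
  have h := pathMean_indicator_card_le hι.1 hP
    (fun (i : Fin n) (z : Fin (ℓ n + 1) → Fin n) => ∑ k, freqMatrix z i k - (ℓ n + 1) * q n i)
    (fun i => β * ((ℓ n + 1) * q n i)) (mul_pos hs0 hn0) (mul_pos hθ hn0) hτ hmean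
  have h' := hY.measure_mem hι.1 hP {z | θ * n < ((Finset.univ.filter fun i =>
        β * ((ℓ n + 1) * q n i) <
          |∑ k, freqMatrix z i k - (ℓ n + 1) * q n i|).card : ℝ)}
  simp only [Set.mem_ofPred_eq] at h'
  rw [h']
  refine ENNReal.ofReal_le_ofReal (h.trans_eq ?_)
  rw [Fintype.card_fin]
  field_simp

end BlockMarkov

/-! ### Transfer of both limits from `X` to `Y` -/

theorem lemma11
    -- the cluster chain
    (K : ℕ) (hK : 1 ≤ K)
    (p : Matrix (Fin K) (Fin K) ℝ) (hp : p ∈ Matrix.rowStochastic ℝ (Fin K))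
    (hp_irr : p.IsIrreducible) (hp_aper : BlockMarkov.IsAperiodic p)
    -- the clusters: nonempty for every `n ≥ K`, with sizes `α_k n + o(n)`
    (σ : ∀ n : ℕ, Fin n → Fin K) (hσ : ∀ n, K ≤ n → Function.Surjective (σ n))
    (α : Fin K → ℝ) (hα_pos : ∀ k, 0 < α k) (hα_sum : ∑ k, α k = 1)
    (hα : ∀ k, (fun n : ℕ => ((Finset.univ.filter fun v => σ n v = k).card : ℝ) - α k * (n : ℝ))
      =o[atTop] fun n : ℕ => (n : ℝ))
    -- the length of the sample path is `lam * n ^ 2 + o(n ^ 2)`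
    (lam : ℝ) (hlam : 0 < lam)
    (ℓ : ℕ → ℕ) (hℓ : (fun n : ℕ => (ℓ n : ℝ) - lam * (n : ℝ) ^ 2) =o[atTop]
      fun n : ℕ => (n : ℝ) ^ 2)
    -- the equilibrium distribution of the block Markov chain on `n` states
    (PiX : ∀ n : ℕ, Fin n → ℝ)
    (hPiX : ∀ n, K ≤ n →
      BlockMarkov.IsEquilibrium (BlockMarkov.blockTransition p (σ n)) (PiX n))
    -- the sample path `X`, started in equilibrium
    {ΩX : ℕ → Type*} [∀ n, MeasurableSpace (ΩX n)] (μX : ∀ n, Measure (ΩX n))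
    (X : ∀ n : ℕ, Fin (ℓ n + 1) → ΩX n → Fin n)
    (hX : ∀ n, K ≤ n →
      BlockMarkov.IsSamplePath (μX n) (PiX n) (BlockMarkov.blockTransition p (σ n)) (X n))
    -- the sample path `Y`, with arbitrary initial distributions
    (ι : ∀ n : ℕ, Fin n → ℝ) (hι : ∀ n, K ≤ n → ι n ∈ stdSimplex ℝ (Fin n))
    {ΩY : ℕ → Type*} [∀ n, MeasurableSpace (ΩY n)] (μY : ∀ n, Measure (ΩY n))
    (Y : ∀ n : ℕ, Fin (ℓ n + 1) → ΩY n → Fin n)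
    (hY : ∀ n, K ≤ n →
      BlockMarkov.IsSamplePath (μY n) (ι n) (BlockMarkov.blockTransition p (σ n)) (Y n)) :
    (∀ ν : Measure ℝ, IsProbabilityMeasure ν →
      BlockMarkov.ConvergesWeaklyInProbability μX
        (fun n ω => BlockMarkov.singularDist
          ((√(n : ℝ))⁻¹ • BlockMarkov.centredFreq (μX n) (X n) ω)) ν →
      BlockMarkov.ConvergesWeaklyInProbability μY
        (fun n ω => BlockMarkov.singularDist
          ((√(n : ℝ))⁻¹ • BlockMarkov.freqMatrix (fun t => Y n t ω))) ν) ∧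
    (∀ ν : Measure ℝ, IsProbabilityMeasure ν →
      BlockMarkov.ConvergesWeaklyInProbability μX
        (fun n ω => BlockMarkov.singularDist
          (√(n : ℝ) • BlockMarkov.rescaledFreq (μX n) (PiX n) (X n) ω)) ν →
      BlockMarkov.ConvergesWeaklyInProbability μY
        (fun n ω => BlockMarkov.singularDist
          (√(n : ℝ) • BlockMarkov.empTransition (fun t => Y n t ω))) ν) := by
  have : Nonempty (Fin K) := ⟨⟨0, hK⟩⟩
  obtain ⟨c, g, hc, hg⟩ := BlockMarkov.exists_poisson_indicator hp hp_irr
  obtain ⟨A, hA, hAσ⟩ := BlockMarkov.eventually_mul_le_clusterSize hα_pos hα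
  have hlen := BlockMarkov.eventually_length_bounds hlam hℓ
  have hev : ∀ {Q : ℕ → Prop}, (∀ n, K ≤ n → Q n) → ∀ᶠ n in atTop, Q n := fun h =>
    (eventually_ge_atTop K).mono h
  have hℓpos : ∀ᶠ n in atTop, 0 < ℓ n := by
    filter_upwards [hlen, eventually_gt_atTop 0] with n hn hn0
    have h1 : (0 : ℝ) < n := by exact_mod_cast hn0
    exact_mod_cast (show (0 : ℝ) < lam / 2 * (n : ℝ) ^ 2 by positivity).trans_le hn.1
  obtain ⟨k₀, hk₀⟩ := Finite.exists_min c
  have hdom : ∀ᶠ n in atTop, ∀ S : Set (Fin (ℓ n) → Fin n),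
      μY n {ω | (fun t : Fin (ℓ n) => Y n t.succ ω) ∈ S} ≤
        ENNReal.ofReal (c k₀)⁻¹ * μX n {ω | (fun t : Fin (ℓ n) => X n t.succ ω) ∈ S} := by
    filter_upwards [hℓpos, eventually_ge_atTop K] with n hn hKn
    refine (hY n hKn).measure_tail_le hn (hX n hKn) (hι n hKn) (hPiX n hKn)
      (BlockMarkov.blockTransition_nonneg hp) (inv_nonneg.mpr (hc k₀).le) fun x y => ?_
    -- Transition and equilibrium probabilities share the denominator `clusterSize`, so the
    -- domination constant is the inverse of the least `c k`, independent of `n`.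
    refine (BlockMarkov.blockTransition_le hp x y).trans ?_
    rw [(hPiX n hKn).apply_eq (hσ n hKn) hg y, mul_div_assoc']
    gcongr
    rw [inv_mul_eq_div, one_le_div (hc k₀)]
    exact hk₀ _
  have hE : ∀ n, K ≤ n → ∀ i j : Fin n,
      (∫ ω, BlockMarkov.freqMatrix (fun t => X n t ω) i j ∂(μX n)) =
        ℓ n * (PiX n i * (p (σ n i) (σ n j) / BlockMarkov.clusterSize (σ n) (σ n j))) := by
    intro n hn i j
    have h1 := (hX n hn).integral_eq (hPiX n hn).1.1 (BlockMarkov.blockTransition_nonneg hp)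
      fun z => BlockMarkov.freqMatrix z i j
    rw [h1, BlockMarkov.pathMean_freqMatrix (hPiX n hn).2
      (BlockMarkov.sum_blockTransition hp (hσ n hn))]
    rfl
  have hrank : ∀ δ : ℝ, 0 < δ → ∀ᶠ n : ℕ in atTop, ((Fintype.card (Fin K) + 1 : ℕ) : ℝ) ≤ δ * n :=
    fun δ hδ => (tendsto_natCast_atTop_atTop.const_mul_atTop hδ).eventually_ge_atTop _
  constructor
  · intro ν hν hconv
    refine BlockMarkov.ConvergesWeaklyInProbability.transfer
      (a := fun n z => (√(n : ℝ))⁻¹ • (BlockMarkov.freqMatrix z -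
        Matrix.of fun i j => ∫ ω', BlockMarkov.freqMatrix (fun t => X n t ω') i j ∂(μX n)))
      (b := fun n z => (√(n : ℝ))⁻¹ • BlockMarkov.freqMatrix z)
      (bad := fun _ _ => ∅) ENNReal.ofReal_ne_top hdom (by simp) ?_ hconv
    intro δ hδ
    filter_upwards [hrank δ hδ, hℓpos, eventually_ge_atTop K] with n hn hℓn hKn x y hxy _
    exact ⟨_, hn, BlockMarkov.comparable_freqMatrix hℓn (σ n)
        (fun i k => ℓ n * (PiX n i * (p (σ n i) k / BlockMarkov.clusterSize (σ n) k)))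
        (hE n hKn) hxy hδ.le _⟩
  · intro ν hν hconv
    refine BlockMarkov.ConvergesWeaklyInProbability.transfer
      (a := fun n z => √(n : ℝ) • ((Matrix.diagonal fun v => ((ℓ n : ℝ) + 1) * PiX n v)⁻¹ *
        (BlockMarkov.freqMatrix z -
          Matrix.of fun i j => ∫ ω', BlockMarkov.freqMatrix (fun t => X n t ω') i j ∂(μX n))))
      (b := fun n z => √(n : ℝ) • BlockMarkov.empTransition z)
      -- Half of the codimension budget `δ * n` goes to exceptional rows, the other half to the
      -- fixed `K + 1` conditions.
      (bad := fun δ n => {z | δ / 2 * n < ((Finset.univ.filter fun i =>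
        δ / (1 + δ) * ((ℓ n + 1) * PiX n i) <
          |∑ k, BlockMarkov.freqMatrix z i k - (ℓ n + 1) * PiX n i|).card : ℝ)})
      ENNReal.ofReal_ne_top hdom ?_ ?_ hconv
    · intro δ hδ
      exact BlockMarkov.tendsto_measure_card_deviation hp (hev hσ) hA hAσ hlam hlen hc hg
        (hev hPiX) (hev hι) (hev hY) (by positivity) (half_pos hδ)
    · intro δ hδ
      filter_upwards [hrank (δ / 2) (half_pos hδ), hℓpos, eventually_ge_atTop K] with
        n hn hℓn hKn x y hxy hy
      have hd : ∀ i, 0 < ((ℓ n : ℝ) + 1) * PiX n i := by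
        intro i
        rw [(hPiX n hKn).apply_eq (hσ n hKn) hg i]
        have h1 := BlockMarkov.clusterSize_pos (hσ n hKn) (σ n i)
        have h2 := hc (σ n i)
        positivity
      refine ⟨_, ?_, BlockMarkov.comparable_empTransition hℓn (σ n)
        (fun i k => ℓ n * (PiX n i * (p (σ n i) k / BlockMarkov.clusterSize (σ n) k)))
        (hE n hKn) hxy hδ.le _ hd⟩
      have hy := not_lt.mp hy
      push_cast at hn ⊢
      linarith
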